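/- All graphs are finite and simple. For a graph $G$ and a vertex set $U$ let $t(U)$ be the number of edges with at least one endpoint in $U$, $e(U)$ the number of edges with both endpoints in $U$, and $\deg(U)=\sum_{v\in U}\deg(v)$. Given a graph $G$ on $n$ vertices and an integer $0\le k\le n$, the (unweighted) Fixed Cost Minimum Edge Cover problem (FCEC) asks for a set $U$ of at least $k$ vertices minimizing $t(U)$, and Dense $k$-Subgraph (DkS) asks for a set $U$ of exactly $k$ vertices maximizing $e(U)$. For constants $a,b>0$ call $(G,k)$ an $(a,b)$-modified instance of DkS if the maximum degree of $G$ lies in $[a n^{1/3}, b n^{1/3}]$, $k\in[a n^{2/3}, b n^{2/3}]$, and the subgraph induced by an optimal DkS solution has average degree in $[a n^{1/3}, b n^{1/3}]$. Theorem 5.2. Suppose that FCEC has a PTAS, i.e. for every $\varepsilon>0$ there is a polynomial-time algorithm which, given $(G,k)$, returns a set $U$ with $|U|\ge k$ such that $t(U)$ is at most $1+\varepsilon$ times the optimum. Then for all constants $a,b>0$ there are a constant $\rho\ge 1$ and a polynomial-time algorithm that, on every $(a,b)$-modified instance $(G,k)$, returns a set $U$ of exactly $k$ vertices such that the DkS optimum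 of $(G,k)$ is at most $\rho\, e(U)$. Moreover, $t(U)=\deg(U)-e(U)$ for every graph and every vertex set $U$. Consequently, if $G$ is $d$-regular and $k\le n$, then the FCEC optimum equals $dk$ minus the DkS optimum, and a set of exactly $k$ vertices is optimal for FCEC if and only if it is optimal for DkS. Here the graph is given by its adjacency matrix, algorithms are deterministic, and polynomial time means polynomial time on a Turing machine. -/

import Mathlib

/-- An input of the (unweighted) problems considered here: a finite simple graph `G` on the
vertices `0, …, n - 1` together with a bound `k ≤ n`. -/
structure BudgetedGraph where
  n : ℕ
  G : SimpleGraph (Fin n)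
  k : ℕ
  k_le : k ≤ n

namespace BudgetedGraph

/-- `t(U)`: the number of edges with at least one endpoint in `U`. -/
noncomputable def touching (I : BudgetedGraph) (U : Finset (Fin I.n)) : ℕ :=
  {e ∈ I.G.edgeSet | ∃ v ∈ U, v ∈ e}.ncard

/-- `e(U)`: the number of edges with both endpoints in `U`. -/
noncomputable def internal (I : BudgetedGraph) (U : Finset (Fin I.n)) : ℕ :=
  {e ∈ I.G.edgeSet | ∀ v ∈ e, v ∈ U}.ncard

/-- The degree of a vertex. -/
noncomputable def deg (I : BudgetedGraph) (v : Fin I.n) : ℕ :=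
  (I.G.neighborSet v).ncard

/-- The maximum degree (`0` for the graph without vertices). -/
noncomputable def maxDeg (I : BudgetedGraph) : ℕ :=
  Finset.univ.sup I.deg

/-- The optimum of Fixed Cost minimum Edge Cover: the least number of edges touching a set of at
least `k` vertices. (The set below is nonempty because `k ≤ n`.) -/
noncomputable def fcecOpt (I : BudgetedGraph) : ℕ :=
  sInf {t | ∃ U : Finset (Fin I.n), I.k ≤ U.card ∧ I.touching U = t}

/-- The optimum of Dense `k`-Subgraph: the largest number of edges inside a set of exactly `k`
vertices. -/
noncomputable def dksOpt (I : BudgetedGraph) : ℕ :=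
  (Finset.univ.powersetCard I.k).sup I.internal

open scoped Classical in
/-- The encoding of an input as a bit string: `n` and `k` in unary, each ended by a `0`, followed by
the adjacency matrix of the graph, row by row. -/
noncomputable def encode (I : BudgetedGraph) : List Bool :=
  List.replicate I.n true ++ [false] ++ List.replicate I.k true ++ [false] ++
    (List.finRange I.n).flatMap fun i => (List.finRange I.n).map fun j => decide (I.G.Adj i j)

end BudgetedGraph

/-- The encoding of a set of vertices of an `n`-vertex graph by its characteristic vector. -/
def encodeVertexSet (S : Σ n : ℕ, Finset (Fin n)) : List Bool :=
  (List.finRange S.1).map fun i => decide (i ∈ S.2)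

/-- A map that assigns to every input a set of vertices. -/
abbrev VertexSelector := ∀ I : BudgetedGraph, Finset (Fin I.n)

/-- The vertex selector is computed by a (deterministic, multi-stack) Turing machine in time
polynomial in the length of the input. -/
def VertexSelector.PolyTime (A : VertexSelector) : Prop :=
  Nonempty (Turing.TM2ComputableInPolyTime BudgetedGraph.encode encodeVertexSet
    fun I => (⟨I.n, A I⟩ : Σ n : ℕ, Finset (Fin n)))

/-- `A` is a `ρ`-approximation for (unweighted) Fixed Cost minimum Edge Cover. -/
def VertexSelector.ApproximatesFCEC (A : VertexSelector) (ρ : ℝ) : Prop :=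
  ∀ I : BudgetedGraph, I.k ≤ (A I).card ∧ (I.touching (A I) : ℝ) ≤ ρ * I.fcecOpt

/-- `A` is a `ρ`-approximation for Dense `k`-Subgraph on the inputs that satisfy `P`. -/
def VertexSelector.ApproximatesDkSOn (A : VertexSelector) (P : BudgetedGraph → Prop) (ρ : ℝ) :
    Prop :=
  ∀ I : BudgetedGraph, P I →
    (A I).card = I.k ∧ (I.dksOpt : ℝ) ≤ ρ * I.internal (A I)

/-- (Unweighted) Fixed Cost minimum Edge Cover has a polynomial time approximation scheme: the
running time is polynomial for every fixed `ε`. -/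
def HasPTASForFCEC : Prop :=
  ∀ ε : ℝ, 0 < ε → ∃ A : VertexSelector, A.PolyTime ∧ A.ApproximatesFCEC (1 + ε)

/-- The modified instances of Dense `k`-Subgraph, with `a` and `b` as the constants of the three
`Θ`s: the maximum degree is `Θ(n^{1/3})`, the size `k` is `Θ(n^{2/3})`, and the subgraph induced by
an optimal set of `k` vertices has average degree `Θ(n^{1/3})`. -/
structure IsModifiedInstance (a b : ℝ) (I : BudgetedGraph) : Prop where
  maxDeg_lower : a * (I.n : ℝ) ^ (1 / 3 : ℝ) ≤ I.maxDeg
  maxDeg_upper : (I.maxDeg : ℝ) ≤ b * (I.n : ℝ) ^ (1 / 3 : ℝ)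
  k_lower : a * (I.n : ℝ) ^ (2 / 3 : ℝ) ≤ I.k
  k_upper : (I.k : ℝ) ≤ b * (I.n : ℝ) ^ (2 / 3 : ℝ)
  avgDeg_lower : a * (I.n : ℝ) ^ (1 / 3 : ℝ) ≤ 2 * (I.dksOpt : ℝ) / I.k
  avgDeg_upper : 2 * (I.dksOpt : ℝ) / I.k ≤ b * (I.n : ℝ) ^ (1 / 3 : ℝ)

/-! By double counting, t(U) + e(U) = deg(U): an edge with both endpoints in U is counted twice on
each side, an edge with one endpoint once. So among sets of k vertices of common degree Δ,
minimizing t is the same as maximizing e. This settles the regular case, since an optimal set for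
FCEC can be shrunk to exactly k vertices without raising t.

For the approximation, let Δ be the maximum degree and OPT the DkS optimum. The FCEC instance solved
is `padded`: every vertex v gets Δ + 1 private new vertices and is joined to Δ - deg(v) of them, and
all n(Δ + 1) new vertices form a clique. Old vertices then have degree Δ and span the original
graph, so the FCEC optimum is at most Δk - OPT. A new vertex alone touches at least n(Δ + 1) - 1 ≥
Δk edges, so good solutions avoid them. In a modified instance OPT is a constant fraction of Δk: Δk
≤ b n^{1/3} k and OPT ≥ a n^{1/3} k / 2. With ε = a/(4b) the error εΔk is at most OPT/2, so t(U) ≤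
Δk - OPT/2, and each k-subset of U spans at least OPT/2 edges. Hence ρ = 2; the core is
`dksOpt_le_two_mul_internal`.

The remaining work is to show that padding and extraction are polynomial on a Turing machine.
Programs over stacks of bits (`Cmd`) have a semantics with time bounds, `Exec`, that carries over to
machines by `Exec.runs`; `polyTime_of_programs` puts such programs before and after a given machine.
The two programs are correct by `ex_prepare`, together with `rows_padded`, and by `ex_extract`. -/

open Turing

/-! ### Fragments of stack machines -/

/-- A piece of code for a machine with several stacks; halting means leaving the fragment. -/
structure Fragment {K : Type} (Γ : K → Type) (σ : Type) where
  Λ : Type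
  fin : Fintype Λ
  main : Λ
  code : Λ → TM2.Stmt Γ Λ σ

namespace Fragment

/-- Rename the labels of a statement by `f`, and replace halting by a jump to `e`
(by halting if `e = none`). -/
def relabel {K : Type} {Γ : K → Type} {σ Λ Λ' : Type} (f : Λ → Λ') (e : Option Λ') :
    TM2.Stmt Γ Λ σ → TM2.Stmt Γ Λ' σ
  | .push k a q => .push k a (relabel f e q)
  | .peek k a q => .peek k a (relabel f e q)
  | .pop k a q => .pop k a (relabel f e q)
  | .load a q => .load a (relabel f e q)
  | .branch p q₁ q₂ => .branch p (relabel f e q₁) (relabel f e q₂)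
  | .goto l => .goto fun v => f (l v)
  | .halt => e.elim .halt fun l => .goto fun _ => l

/-- The action of `relabel` on configurations. -/
def relabelCfg {K : Type} {Γ : K → Type} {σ Λ Λ' : Type} (f : Λ → Λ') (e : Option Λ')
    (c : TM2.Cfg Γ Λ σ) : TM2.Cfg Γ Λ' σ :=
  ⟨c.l.elim e fun l => some (f l), c.var, c.stk⟩

section

variable {K : Type} [DecidableEq K] {Γ : K → Type} {σ Λ Λ' : Type}

theorem stepAux_relabel (f : Λ → Λ') (e : Option Λ') (q : TM2.Stmt Γ Λ σ) (v : σ)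
    (S : ∀ k, List (Γ k)) :
    TM2.stepAux (relabel f e q) v S = relabelCfg f e (TM2.stepAux q v S) := by
  induction q generalizing v S with
  | push k a q ih => exact ih _ _
  | peek k a q ih => exact ih _ _
  | pop k a q ih => exact ih _ _
  | load a q ih => exact ih _ _
  | branch p q₁ q₂ ih₁ ih₂ =>
    simp only [relabel, TM2.stepAux]
    cases p v
    · exact ih₂ _ _
    · exact ih₁ _ _
  | goto l => rfl
  | halt => cases e <;> rfl

/-- The machine with code `m` gets from one configuration to another in exactly `n` steps. -/
inductive ReachesIn (m : Λ → TM2.Stmt Γ Λ σ) : ℕ → TM2.Cfg Γ Λ σ → TM2.Cfg Γ Λ σ → Prop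
  | refl (c) : ReachesIn m 0 c c
  | head {n : ℕ} (l : Λ) (v : σ) (S : ∀ k, List (Γ k)) {c : TM2.Cfg Γ Λ σ}
      (h : ReachesIn m n (TM2.stepAux (m l) v S) c) : ReachesIn m (n + 1) ⟨some l, v, S⟩ c

theorem ReachesIn.trans {m : Λ → TM2.Stmt Γ Λ σ} {n₁ n₂ : ℕ} {c₁ c₂ c₃ : TM2.Cfg Γ Λ σ}
    (h₁ : ReachesIn m n₁ c₁ c₂) (h₂ : ReachesIn m n₂ c₂ c₃) : ReachesIn m (n₁ + n₂) c₁ c₃ := by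
  induction h₁ with
  | refl c => simpa using h₂
  | head l v S h ih =>
    rw [Nat.add_right_comm]
    exact .head l v S (ih h₂)

theorem ReachesIn.relabel {m : Λ → TM2.Stmt Γ Λ σ} {m' : Λ' → TM2.Stmt Γ Λ' σ} {f : Λ → Λ'}
    {e : Option Λ'} (hm : ∀ l, m' (f l) = Fragment.relabel f e (m l)) {n : ℕ}
    {c₁ c₂ : TM2.Cfg Γ Λ σ} (h : ReachesIn m n c₁ c₂) :
    ReachesIn m' n (relabelCfg f e c₁) (relabelCfg f e c₂) := by
  induction h with
  | refl c => exact .refl _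
  | head l v S h ih =>
    refine .head (f l) v S ?_
    rw [hm, stepAux_relabel]
    exact ih

theorem iterate_bind_none {α : Type*} (f : α → Option α) (n : ℕ) :
    (flip bind f)^[n] none = none := by
  induction n with
  | zero => rfl
  | succ n ih => rw [Function.iterate_succ_apply]; exact ih

/-- Links the inductive relation with the iterated step function in `TM2OutputsInTime`. A halted
configuration has no successor, so a run of positive length starts at a label. -/
theorem reachesIn_iff (m : Λ → TM2.Stmt Γ Λ σ) (n : ℕ) (c₁ c₂ : TM2.Cfg Γ Λ σ) :
    ReachesIn m n c₁ c₂ ↔ (flip bind (TM2.step m))^[n] (some c₁) = some c₂ := by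
  constructor
  · intro h
    induction h with
    | refl c => rfl
    | head l v S h ih => rw [Function.iterate_succ_apply]; exact ih
  · induction n generalizing c₁ with
    | zero =>
      intro h
      cases h
      exact .refl _
    | succ n ih =>
      rw [Function.iterate_succ_apply]
      obtain ⟨_ | l, v, S⟩ := c₁
      · intro h
        have h' : (flip bind (TM2.step m))^[n] none = some c₂ := h
        rw [iterate_bind_none] at h'
        cases h'
      · intro h
        exact .head l v S (ih _ h)

/-- Started with the stacks `S`, the fragment is left with the stacks `S'` after at most `t` steps;
the internal state is `v` at both times. -/
def Runs (F : Fragment Γ σ) (v : σ) (S S' : ∀ k, List (Γ k)) (t : ℕ) : Prop :=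
  ∃ n ≤ t, ReachesIn F.code n ⟨some F.main, v, S⟩ ⟨none, v, S'⟩

theorem Runs.mono {F : Fragment Γ σ} {v : σ} {S S' : ∀ k, List (Γ k)} {t t' : ℕ}
    (h : F.Runs v S S' t) (ht : t ≤ t') : F.Runs v S S' t' :=
  let ⟨n, hn, h⟩ := h
  ⟨n, hn.trans ht, h⟩

/-- The empty fragment. -/
def skip : Fragment Γ σ := ⟨Unit, inferInstance, (), fun _ => .halt⟩

theorem runs_skip (v : σ) (S : ∀ k, List (Γ k)) : (skip : Fragment Γ σ).Runs v S S 1 :=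
  ⟨1, le_rfl, .head _ _ _ (.refl _)⟩

/-- Push a symbol. -/
def push (k : K) (a : Γ k) : Fragment Γ σ :=
  ⟨Unit, inferInstance, (), fun _ => .push k (fun _ => a) .halt⟩

theorem runs_push (k : K) (a : Γ k) (v : σ) (S : ∀ k, List (Γ k)) :
    (push k a : Fragment Γ σ).Runs v S (Function.update S k (a :: S k)) 1 :=
  ⟨1, le_rfl, .head _ _ _ (.refl _)⟩

/-- Run two fragments one after the other. -/
def seq (F G : Fragment Γ σ) : Fragment Γ σ where
  Λ := F.Λ ⊕ G.Λ
  fin := @instFintypeSum _ _ F.fin G.fin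
  main := .inl F.main
  code := Sum.elim (fun l => relabel .inl (some (.inr G.main)) (F.code l))
    fun l => relabel .inr none (G.code l)

/-- Times simply add: the halt of `F` becomes a jump to `G`, which costs no further step. -/
theorem Runs.seq {F G : Fragment Γ σ} {v : σ} {S₁ S₂ S₃ : ∀ k, List (Γ k)} {t₁ t₂ : ℕ}
    (h₁ : F.Runs v S₁ S₂ t₁) (h₂ : G.Runs v S₂ S₃ t₂) : (F.seq G).Runs v S₁ S₃ (t₁ + t₂) := by
  obtain ⟨n₁, hn₁, h₁⟩ := h₁
  obtain ⟨n₂, hn₂, h₂⟩ := h₂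
  exact ⟨n₁ + n₂, add_le_add hn₁ hn₂,
    (h₁.relabel (m' := (F.seq G).code) (f := .inl) (e := some (.inr G.main)) fun _ => rfl).trans
      (h₂.relabel (m' := (F.seq G).code) (f := .inr) (e := none) fun _ => rfl)⟩

end

section

variable {K : Type} [DecidableEq K] {Γ : K → Type} {τ : Type}

/-- Pop a symbol `o` from the stack `k` (`o = none` if the stack is empty), run `F o`, and start
again if `again o`. -/
def test (k : K) (e : Γ k ≃ Bool) (F : Option Bool → Fragment Γ (τ × Option Bool))
    (again : Option Bool → Bool) : Fragment Γ (τ × Option Bool) where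
  Λ := Option (Σ o, (F o).Λ)
  fin := @instFintypeOption _ (@Sigma.instFintype _ _ (fun o => (F o).fin) _)
  main := none
  code
    | none => .pop k (fun v o => (v.1, o.map e)) <|
        .branch (fun v => v.2.isNone)
          (.load (fun v => (v.1, none)) <| .goto fun _ => some ⟨none, (F none).main⟩) <|
        .branch (fun v => v.2 == some true)
          (.load (fun v => (v.1, none)) <| .goto fun _ => some ⟨some true, (F (some true)).main⟩)
          (.load (fun v => (v.1, none)) <| .goto fun _ => some ⟨some false, (F (some false)).main⟩)
    | some ⟨o, l⟩ =>
      relabel (fun l => some ⟨o, l⟩) (bif again o then some none else none) ((F o).code l)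

variable {k : K} {e : Γ k ≃ Bool} {F : Option Bool → Fragment Γ (τ × Option Bool)}
  {again : Option Bool → Bool} {s : τ} {S S₂ S₃ : ∀ k, List (Γ k)} {t₁ t₂ : ℕ}

/-- The popped bit sits in the second component of the state only within this one step; the branches
read it before it is reset to `none`. Every fragment therefore starts and ends in the same state. -/
theorem stepAux_test (S : ∀ k, List (Γ k)) :
    TM2.stepAux ((test k e F again).code none) (s, none) S =
      ⟨some (some ⟨(S k).head?.map e, (F ((S k).head?.map e)).main⟩), (s, none),
        Function.update S k (S k).tail⟩ := by
  simp only [test, TM2.stepAux]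
  cases (S k).head? with
  | none => rfl
  | some a =>
    simp only [Option.map_some]
    generalize e a = b
    cases b <;> rfl

theorem Runs.test_exit (ha : again ((S k).head?.map e) = false)
    (h : (F ((S k).head?.map e)).Runs (s, none) (Function.update S k (S k).tail) S₂ t₁) :
    (test k e F again).Runs (s, none) S S₂ (t₁ + 1) := by
  obtain ⟨n, hn, h⟩ := h
  refine ⟨n + 1, Nat.succ_le_succ hn, .head _ _ _ ?_⟩
  have := h.relabel (m' := (test k e F again).code)
    (f := fun l => some ⟨(S k).head?.map e, l⟩)
    (e := bif again ((S k).head?.map e) then some none else none) fun _ => rfl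
  rw [ha] at this
  exact (stepAux_test (F := F) (again := again) S).symm ▸ this

theorem Runs.test_again (ha : again ((S k).head?.map e) = true)
    (h : (F ((S k).head?.map e)).Runs (s, none) (Function.update S k (S k).tail) S₂ t₁)
    (h' : (test k e F again).Runs (s, none) S₂ S₃ t₂) :
    (test k e F again).Runs (s, none) S S₃ (t₁ + t₂ + 1) := by
  obtain ⟨n, hn, h⟩ := h
  obtain ⟨n', hn', h'⟩ := h'
  refine ⟨n + n' + 1, by omega, .head _ _ _ ?_⟩
  have := h.relabel (m' := (test k e F again).code)
    (f := fun l => some ⟨(S k).head?.map e, l⟩)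
    (e := bif again ((S k).head?.map e) then some none else none) fun _ => rfl
  rw [ha] at this
  exact (stepAux_test (F := F) (again := again) S).symm ▸ this.trans h'

end

end Fragment

/-! ### A small programming language for stacks of bits -/

/-- Programs that manipulate stacks of bits with names in `J`. The program `test j c again` pops a
bit `o` from the stack `j` (`o = none` if it is empty), runs `c o`, and starts again if
`again o`. -/
inductive Cmd (J : Type)
  | skip : Cmd J
  | push (j : J) (b : Bool) : Cmd J
  | seq (c₁ c₂ : Cmd J) : Cmd J
  | test (j : J) (c : Option Bool → Cmd J) (again : Option Bool → Bool) : Cmd J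

namespace Cmd

variable {J : Type} [DecidableEq J]

/-- `Exec c x y t`: started with the stacks `x`, the program `c` ends with the stacks `y`, in time
at most `t`. -/
inductive Exec : Cmd J → (J → List Bool) → (J → List Bool) → ℕ → Prop
  | skip (x) : Exec .skip x x 1
  | push (j b x) : Exec (.push j b) x (Function.update x j (b :: x j)) 1
  | seq {c₁ c₂ x y z t₁ t₂} (h₁ : Exec c₁ x y t₁) (h₂ : Exec c₂ y z t₂) :
      Exec (.seq c₁ c₂) x z (t₁ + t₂)
  | test_exit {j c again x y t} (ha : again (x j).head? = false)
      (h : Exec (c (x j).head?) (Function.update x j (x j).tail) y t) :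
      Exec (.test j c again) x y (t + 1)
  | test_again {j c again x y z t₁ t₂} (ha : again (x j).head? = true)
      (h : Exec (c (x j).head?) (Function.update x j (x j).tail) y t₁)
      (h' : Exec (.test j c again) y z t₂) :
      Exec (.test j c again) x z (t₁ + t₂ + 1)
  | mono {c x y t t'} (h : Exec c x y t) (ht : t ≤ t') : Exec c x y t'

variable {K : Type} [DecidableEq K] {Γ : K → Type} {τ : Type}

/-- The stack alphabets of a machine with additional stacks of bits. -/
abbrev Alphabet (Γ : K → Type) (J : Type) : K ⊕ J → Type
  | .inl k => Γ k
  | .inr _ => Bool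

/-- The stacks of a machine with additional stacks of bits. -/
def joined (S : ∀ k, List (Γ k)) (x : J → List Bool) : ∀ k, List (Alphabet Γ J k)
  | .inl k => S k
  | .inr j => x j

theorem update_joined_inr (S : ∀ k, List (Γ k)) (x : J → List Bool) (j : J) (l : List Bool) :
    Function.update (joined S x) (.inr j) l = joined S (Function.update x j l) := by
  funext k
  rcases k with k | i
  · rw [Function.update_of_ne (by simp)]; rfl
  · rcases eq_or_ne i j with rfl | h
    · rw [Function.update_self]; simp [joined]
    · rw [Function.update_of_ne (by simpa using h)]; simp [joined, h]

theorem update_joined_inl (S : ∀ k, List (Γ k)) (x : J → List Bool) (k : K) (l : List (Γ k)) :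
    Function.update (joined S x) (.inl k) l = joined (Function.update S k l) x := by
  funext i
  rcases i with i | j
  · rcases eq_or_ne i k with rfl | h
    · rw [Function.update_self]; simp [joined]
    · rw [Function.update_of_ne (by simpa using h)]; simp [joined, h]
  · rw [Function.update_of_ne (by simp)]; rfl

/-- The translation of programs into fragments of a machine with additional stacks. -/
def compile (Γ : K → Type) (τ : Type) : Cmd J → Fragment (Alphabet Γ J) (τ × Option Bool)
  | .skip => .skip
  | .push j b => .push (.inr j) b
  | .seq c₁ c₂ => .seq (compile Γ τ c₁) (compile Γ τ c₂)
  | .test j c again => .test (.inr j) (Equiv.refl Bool) (fun o => compile Γ τ (c o)) again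

/-- Compilation preserves the time bound exactly. The induction is on the derivation, which is
finite, so loops need no separate termination argument. -/
theorem Exec.runs {c : Cmd J} {x y : J → List Bool} {t : ℕ} (h : Exec c x y t) (s : τ)
    (S : ∀ k, List (Γ k)) :
    (compile Γ τ c).Runs (s, none) (joined S x) (joined S y) t := by
  induction h with
  | skip x => exact Fragment.runs_skip _ _
  | push j b x =>
    rw [← update_joined_inr]
    exact Fragment.runs_push (Γ := Alphabet Γ J) (.inr j) b _ (joined S x)
  | seq h₁ h₂ ih₁ ih₂ => exact ih₁.seq ih₂
  | @test_exit j c again x y t ha h ih =>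
    have hx : ((joined S x (.inr j)).head?.map (Equiv.refl Bool) : Option Bool) = (x j).head? := by
      change (x j).head?.map id = _
      simp
    refine Fragment.Runs.test_exit (by rw [hx]; exact ha) ?_
    rw [hx]
    exact (update_joined_inr S x j _).symm ▸ ih
  | @test_again j c again x y z t₁ t₂ ha h h' ih ih' =>
    have hx : ((joined S x (.inr j)).head?.map (Equiv.refl Bool) : Option Bool) = (x j).head? := by
      change (x j).head?.map id = _
      simp
    refine Fragment.Runs.test_again (by rw [hx]; exact ha) ?_ ih'
    rw [hx]
    exact (update_joined_inr S x j _).symm ▸ ih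
  | mono h ht ih => exact ih.mono ht

end Cmd

/-! ### Running a given machine beside additional stacks -/

namespace Fragment

variable {K J : Type} [DecidableEq K] [DecidableEq J] {Γ : K → Type} {τ : Type}

/-- The code of a machine as code of a machine with additional stacks of bits. -/
def liftStmt (J : Type) {Λ : Type} :
    TM2.Stmt Γ Λ τ → TM2.Stmt (Cmd.Alphabet Γ J) Λ (τ × Option Bool)
  | .push k a q => .push (.inl k) (fun v => a v.1) (liftStmt J q)
  | .peek k a q => .peek (.inl k) (fun v o => (a v.1 o, v.2)) (liftStmt J q)
  | .pop k a q => .pop (.inl k) (fun v o => (a v.1 o, v.2)) (liftStmt J q)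
  | .load a q => .load (fun v => (a v.1, v.2)) (liftStmt J q)
  | .branch p q₁ q₂ => .branch (fun v => p v.1) (liftStmt J q₁) (liftStmt J q₂)
  | .goto l => .goto fun v => l v.1
  | .halt => .halt

theorem stepAux_liftStmt {Λ : Type} (q : TM2.Stmt Γ Λ τ) (v : τ) (o : Option Bool)
    (S : ∀ k, List (Γ k)) (x : J → List Bool) :
    TM2.stepAux (liftStmt J q) (v, o) (Cmd.joined S x) =
      ⟨(TM2.stepAux q v S).l, ((TM2.stepAux q v S).var, o),
        Cmd.joined (TM2.stepAux q v S).stk x⟩ := by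
  induction q generalizing v S with
  | push k a q ih =>
    simp only [liftStmt, TM2.stepAux]
    rw [← ih, ← Cmd.update_joined_inl]
    rfl
  | peek k a q ih => exact ih _ _
  | pop k a q ih =>
    simp only [liftStmt, TM2.stepAux]
    rw [← ih, ← Cmd.update_joined_inl]
    rfl
  | load a q ih => exact ih _ _
  | branch p q₁ q₂ ih₁ ih₂ =>
    simp only [liftStmt, TM2.stepAux]
    cases p v
    · exact ih₂ _ _
    · exact ih₁ _ _
  | goto l => rfl
  | halt => rfl

theorem ReachesIn.lift {Λ : Type} {m : Λ → TM2.Stmt Γ Λ τ} {n : ℕ} {c₁ c₂ : TM2.Cfg Γ Λ τ}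
    (h : ReachesIn m n c₁ c₂) (o : Option Bool) (x : J → List Bool) :
    ReachesIn (fun l => liftStmt J (m l)) n ⟨c₁.l, (c₁.var, o), Cmd.joined c₁.stk x⟩
      ⟨c₂.l, (c₂.var, o), Cmd.joined c₂.stk x⟩ := by
  induction h with
  | refl c => exact .refl _
  | head l v S h ih =>
    refine .head l _ _ ?_
    rw [stepAux_liftStmt]
    exact ih

/-- A machine as a fragment of a machine with additional stacks of bits. -/
def ofMachine (J : Type) (M : FinTM2) : Fragment (Cmd.Alphabet M.Γ J) (M.σ × Option Bool) :=
  ⟨M.Λ, M.ΛFin, M.main, fun l => liftStmt J (M.m l)⟩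

/-- The stacks that are empty except for the stack `k`. -/
def single (k : K) (l : List (Γ k)) : ∀ k, List (Γ k) := Function.update (fun _ => []) k l

theorem initList_eq (M : FinTM2) (l : List (M.Γ M.k₀)) :
    initList M l = ⟨some M.main, M.initialState, single M.k₀ l⟩ := by
  unfold initList single
  congr 1
  funext k
  by_cases h : k = M.k₀
  · subst h; simp
  · simp [h]

theorem haltList_eq (M : FinTM2) (l : List (M.Γ M.k₁)) :
    haltList M l = ⟨none, M.initialState, single M.k₁ l⟩ := by
  unfold haltList single
  congr 1
  funext k
  by_cases h : k = M.k₁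
  · subst h; simp
  · simp [h]

/-- Halting with output includes a return to the initial state with all other stacks empty, so
another fragment can follow without any cleaning up. -/
theorem runs_ofMachine {M : FinTM2} {l : List (M.Γ M.k₀)} {l' : List (M.Γ M.k₁)} {t : ℕ}
    (h : TM2OutputsInTime M l (some l') t) (x : J → List Bool) :
    (ofMachine J M).Runs (M.initialState, none) (Cmd.joined (single M.k₀ l) x)
      (Cmd.joined (single M.k₁ l') x) t := by
  obtain ⟨⟨n, h⟩, hn⟩ := h
  refine ⟨n, hn, ?_⟩
  have h' : ReachesIn M.m n (initList M l) (haltList M l') := (reachesIn_iff _ _ _ _).2 h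
  rw [initList_eq, haltList_eq] at h'
  exact h'.lift none x

end Fragment

/-! ### Transfer between stacks, and composition of polynomial-time computations -/

namespace Fragment

section

variable {K : Type} [DecidableEq K] {Γ : K → Type} {τ : Type}

/-- Move the contents of the stack `k` to the stack `k'`, reversing their order. -/
def move (k k' : K) (e : Γ k ≃ Bool) (e' : Γ k' ≃ Bool) : Fragment Γ (τ × Option Bool) :=
  test k e (fun o => o.elim skip fun b => push k' (e'.symm b)) Option.isSome

/-- Each symbol costs one pop and one push; the final failed pop and the empty fragment cost 2.
Because of the reversal, words that are to be handed over are prepared backwards. -/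
theorem runs_move {k k' : K} (hk : k ≠ k') (e : Γ k ≃ Bool) (e' : Γ k' ≃ Bool) (s : τ)
    (l : List (Γ k)) (S : ∀ k, List (Γ k)) (hl : S k = l) :
    (move k k' e e' : Fragment Γ (τ × Option Bool)).Runs (s, none) S
      (Function.update (Function.update S k []) k' ((l.map fun a => e'.symm (e a)).reverse ++ S k'))
      (2 * l.length + 2) := by
  induction l generalizing S with
  | nil =>
    refine Runs.test_exit (by rw [hl]; rfl) ?_
    rw [hl]
    have : Function.update (Function.update S k []) k' ([] ++ S k') = Function.update S k [] := by
      rw [List.nil_append, Function.update_eq_self_iff, Function.update_of_ne hk.symm]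
    simp only [List.map_nil, List.reverse_nil, this]
    exact runs_skip _ _
  | cons a l ih =>
    have h₁ := runs_push (σ := τ × Option Bool) k' (e'.symm (e a)) (s, none)
      (Function.update S k l)
    have h₂ := ih (Function.update (Function.update S k l) k'
      (e'.symm (e a) :: Function.update S k l k')) (by
        rw [Function.update_of_ne hk, Function.update_self])
    have h₃ := Runs.test_again (k := k) (e := e) (S := S)
      (F := fun o => o.elim skip fun b => push k' (e'.symm b)) (again := Option.isSome)
      (by rw [hl]; rfl) (by rw [hl]; exact h₁) h₂
    refine Eq.mp ?_ (h₃.mono (t' := 2 * (a :: l).length + 2) (by simp; omega))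
    congr 1
    rw [Function.update_self, Function.update_of_ne hk.symm]
    funext i
    rcases eq_or_ne i k' with rfl | hi
    · simp
    · rcases eq_or_ne i k with rfl | hi'
      · simp [hi]
      · simp [hi, hi']

end

/-- A machine that starts with a fragment. -/
def toMachine {K : Type} [DecidableEq K] [Fintype K] {Γ : K → Type} {σ : Type} [Fintype σ]
    (F : Fragment Γ σ) (k₀ k₁ : K) [Fintype (Γ k₀)] (v : σ) : FinTM2 :=
  { K := K, k₀ := k₀, k₁ := k₁, Γ := Γ, Λ := F.Λ, main := F.main, ΛFin := F.fin, σ := σ,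
    initialState := v, m := F.code }

theorem Runs.outputs {K : Type} [DecidableEq K] [Fintype K] {Γ : K → Type} {σ : Type} [Fintype σ]
    {F : Fragment Γ σ} {k₀ k₁ : K} [Fintype (Γ k₀)] {v : σ} {l : List (Γ k₀)} {l' : List (Γ k₁)}
    {t : ℕ} (h : F.Runs v (single k₀ l) (single k₁ l') t) :
    Nonempty (TM2OutputsInTime (toMachine F k₀ k₁ v) l (some l') t) := by
  obtain ⟨n, hn, h⟩ := h
  refine ⟨⟨n, ?_⟩, hn⟩
  have := (reachesIn_iff _ _ _ _).1 h
  refine Eq.trans (congrArg _ (congrArg some (initList_eq (toMachine F k₀ k₁ v) l)))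
    (this.trans (congrArg some (haltList_eq (toMachine F k₀ k₁ v) l').symm))

end Fragment

namespace Cmd

variable {J : Type} [DecidableEq J]

/-- The stacks that are empty except for the stack `j`. -/
def only (j : J) (l : List Bool) : J → List Bool := Function.update (fun _ => []) j l

theorem joined_nil {K : Type} [DecidableEq K] {Γ : K → Type} (j : J) (l : List Bool) :
    joined (fun k => ([] : List (Γ k))) (only j l) = Fragment.single (Γ := Alphabet Γ J) (.inr j) l := by
  unfold only Fragment.single
  rw [← update_joined_inr]
  congr 1
  funext k
  cases k <;> rfl

end Cmd

theorem Polynomial.eval_le_eval_nat (p : Polynomial ℕ) {m n : ℕ} (h : m ≤ n) :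
    p.eval m ≤ p.eval n := by
  rw [Polynomial.eval_eq_sum, Polynomial.eval_eq_sum]
  exact Finset.sum_le_sum fun i _ => Nat.mul_le_mul_left _ (Nat.pow_le_pow_left h i)

/-- If `f` is computable in polynomial time, then so is every function `g` that is computed by a
program that prepares an input of `f`, computes `f`, and processes the result. -/
theorem polyTime_of_programs {α β α' β' : Type} {ea : α → List Bool} {eb : β → List Bool}
    {ea' : α' → List Bool} {eb' : β' → List Bool} {f : α → β} {g : α' → β'}
    (A : TM2ComputableInPolyTime ea eb f) {J : Type} [DecidableEq J] [Fintype J] (inp mid out : J)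
    (pre post : Cmd J) (r : α' → α) (p : Polynomial ℕ)
    (hmid : ∀ a, (ea (r a)).length ≤ p.eval (ea' a).length)
    (hmid' : ∀ a, (eb (f (r a))).length ≤ p.eval (ea' a).length)
    (h : ∀ a, ∃ x : J → List Bool, x mid = [] ∧
      pre.Exec (Cmd.only inp (ea' a)) (Function.update x mid (ea (r a)).reverse)
        (p.eval (ea' a).length) ∧
      post.Exec (Function.update x mid (eb (f (r a))).reverse) (Cmd.only out (eb' (g a)))
        (p.eval (ea' a).length)) :
    Nonempty (TM2ComputableInPolyTime ea' eb' g) := by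
  let M := A.tm
  let F : Fragment (Cmd.Alphabet M.Γ J) (M.σ × Option Bool) :=
    (pre.compile M.Γ M.σ).seq <|
      (Fragment.move (Γ := Cmd.Alphabet M.Γ J) (.inr mid) (.inl M.k₀) (Equiv.refl Bool)
        A.inputAlphabet).seq <|
      (Fragment.ofMachine J M).seq <|
      (Fragment.move (Γ := Cmd.Alphabet M.Γ J) (.inl M.k₁) (.inr mid) A.outputAlphabet
        (Equiv.refl Bool)).seq <| post.compile M.Γ M.σ
  -- One summand per phase: preparation, transfer to the machine, the machine, transfer back,
  -- postprocessing.
  let q : Polynomial ℕ := p + ((2 * p + 2) + (A.time.comp p + ((2 * p + 2) + p)))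
  have : Fintype M.K := M.kFin
  have : Fintype M.σ := M.σFin
  have hF : ∀ a, F.Runs (M.initialState, none)
      (Fragment.single (.inr inp) (ea' a)) (Fragment.single (.inr out) (eb' (g a)))
      (q.eval (ea' a).length) := by
    intro a
    obtain ⟨x, hx, h₁, h₅⟩ := h a
    replace h₁ := h₁.runs (Γ := M.Γ) M.initialState fun _ => []
    replace h₅ := h₅.runs (Γ := M.Γ) M.initialState fun _ => []
    rw [Cmd.joined_nil] at h₁ h₅
    have h₂ := Fragment.runs_move (Γ := Cmd.Alphabet M.Γ J) (k := .inr mid) (k' := .inl M.k₀)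
      (by simp) (Equiv.refl Bool) A.inputAlphabet M.initialState (ea (r a)).reverse
      (Cmd.joined (fun _ => []) (Function.update x mid (ea (r a)).reverse)) (by simp [Cmd.joined])
    -- As `mid` is empty in `x`, emptying it by the transfer leaves exactly `x`, which waits
    -- untouched while the machine runs.
    rw [Cmd.update_joined_inr, Cmd.update_joined_inl, Function.update_idem,
      ← hx, Function.update_eq_self] at h₂
    have h₃ := Fragment.runs_ofMachine (A.outputsFun (r a)) x
    have h₄ := Fragment.runs_move (Γ := Cmd.Alphabet M.Γ J) (k := .inl M.k₁) (k' := .inr mid)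
      (by simp) A.outputAlphabet (Equiv.refl Bool) M.initialState
      ((eb (f (r a))).map A.outputAlphabet.invFun)
      (Cmd.joined (Fragment.single M.k₁ ((eb (f (r a))).map A.outputAlphabet.invFun)) x)
      (by simp [Cmd.joined, Fragment.single])
    rw [Cmd.update_joined_inl, Cmd.update_joined_inr] at h₄
    simp only [Cmd.joined, Fragment.single, hx, Function.update_idem, List.map_map] at h₄
    have e₁ : (((ea (r a)).reverse.map fun b =>
        A.inputAlphabet.symm ((Equiv.refl Bool) b)).reverse ++ ([] : List (M.Γ M.k₀))) =
        (ea (r a)).map A.inputAlphabet.invFun := by simp [M]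
    have e₂ : Function.update (fun k => ([] : List (M.Γ k))) M.k₁ [] = fun _ => [] :=
      Function.update_eq_self _ _
    have e₃ : (eb (f (r a))).map ((fun c => (Equiv.refl Bool).symm (A.outputAlphabet c)) ∘
        A.outputAlphabet.invFun) = eb (f (r a)) := by
      conv_rhs => rw [← List.map_id (eb (f (r a)))]
      congr 1
      funext b
      simp
    simp only [Cmd.joined] at h₂
    refine (h₁.seq (Fragment.Runs.seq (t₁ := 2 * (ea (r a)).length + 2)
      (S₂ := Cmd.joined (Fragment.single M.k₀ ((ea (r a)).map A.inputAlphabet.invFun)) x) ?_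
        (h₃.seq (Fragment.Runs.seq (t₁ := 2 * (eb (f (r a))).length + 2)
        (S₂ := Cmd.joined (fun _ => []) (Function.update x mid (eb (f (r a))).reverse)) ?_
          h₅)))).mono ?_
    · rw [← e₁]
      simpa [Fragment.single] using h₂
    · rw [e₂] at h₄
      have h₄' := h₄
      rw [show _ = _ from e₃] at h₄'
      simpa [Fragment.single] using h₄'
    · have := Polynomial.eval_le_eval_nat A.time (hmid a)
      have := hmid a
      have := hmid' a
      simp only [q, Polynomial.eval_add, Polynomial.eval_mul, Polynomial.eval_comp,
        Polynomial.eval_ofNat]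
      omega
  exact ⟨{
    tm := F.toMachine (.inr inp) (.inr out) (M.initialState, none)
    inputAlphabet := Equiv.refl Bool
    outputAlphabet := Equiv.refl Bool
    time := q
    outputsFun := fun a => by
      have := (hF a).outputs.some
      refine Eq.mp ?_ this
      have e : ∀ l : List Bool, l.map (Equiv.refl Bool).invFun = l := List.map_id
      exact (congrArg₂ (fun l l' => TM2OutputsInTime
        (F.toMachine (.inr inp) (.inr out) (M.initialState, none)) l (some l')
          (q.eval (ea' a).length)) (e _) (e _)).symm }⟩

/-! ### Double counting of edges, and regular graphs -/

namespace BudgetedGraph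

/-- Exchanging sums, it suffices to look at one edge: if i of its two endpoints lie in U, then i =
[i ≥ 1] + [i = 2]. -/
theorem touching_add_internal (I : BudgetedGraph) (U : Finset (Fin I.n)) :
    I.touching U + I.internal U = ∑ v ∈ U, I.deg v := by
  classical
  have h₁ : I.touching U = ∑ e ∈ I.G.edgeFinset, if ∃ v ∈ U, v ∈ e then 1 else 0 := by
    rw [touching, ← Finset.card_filter, ← Set.ncard_coe_finset]
    congr 1
    ext e
    simp
  have h₂ : I.internal U = ∑ e ∈ I.G.edgeFinset, if ∀ v ∈ e, v ∈ U then 1 else 0 := by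
    rw [internal, ← Finset.card_filter, ← Set.ncard_coe_finset]
    congr 1
    ext e
    simp
  have h₃ : ∀ v, I.deg v = ∑ e ∈ I.G.edgeFinset, if v ∈ e then 1 else 0 := by
    intro v
    rw [deg, ← Finset.card_filter, ← SimpleGraph.coe_neighborFinset, Set.ncard_coe_finset,
      SimpleGraph.card_neighborFinset_eq_degree, ← SimpleGraph.card_incidenceFinset_eq_degree,
      SimpleGraph.incidenceFinset_eq_filter]
  rw [h₁, h₂, Finset.sum_congr rfl fun v _ => h₃ v, Finset.sum_comm, ← Finset.sum_add_distrib]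
  refine Finset.sum_congr rfl fun e he => ?_
  induction e using Sym2.ind with
  | _ a b =>
    have hab : a ≠ b := by
      rintro rfl
      simp at he
    have h : ∀ v, (if v ∈ s(a, b) then 1 else 0) =
        (if v = a then 1 else 0) + if v = b then 1 else 0 := by
      intro v
      by_cases h₁ : v = a
      · subst h₁; simp [hab]
      · simp [h₁]
    simp_rw [h, Finset.sum_add_distrib, Finset.sum_ite_eq']
    have h₄ : (∃ v ∈ U, v ∈ s(a, b)) ↔ a ∈ U ∨ b ∈ U := by
      simp only [Sym2.mem_iff]
      grind
    have h₅ : (∀ v ∈ s(a, b), v ∈ U) ↔ a ∈ U ∧ b ∈ U := by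
      simp
    simp_rw [h₄, h₅]
    by_cases ha : a ∈ U <;> by_cases hb : b ∈ U <;> simp [ha, hb]

theorem touching_mono (I : BudgetedGraph) {U V : Finset (Fin I.n)} (h : U ⊆ V) :
    I.touching U ≤ I.touching V :=
  Set.ncard_le_ncard (fun _ ⟨he, v, hv, hve⟩ => ⟨he, v, h hv, hve⟩) (Set.toFinite _)

/-- Without loops no edge lies inside a single vertex, so t({v}) = deg(v); then t is monotone. -/
theorem deg_le_touching (I : BudgetedGraph) {U : Finset (Fin I.n)} {v : Fin I.n} (hv : v ∈ U) :
    I.deg v ≤ I.touching U := by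
  refine le_trans ?_ (I.touching_mono (Finset.singleton_subset_iff.2 hv))
  have h := I.touching_add_internal {v}
  have h' : I.internal {v} = 0 := by
    rw [internal, Set.ncard_eq_zero]
    ext e
    induction e using Sym2.ind with
    | _ a b =>
      simp only [Set.mem_ofPred_eq, SimpleGraph.mem_edgeSet, Sym2.mem_iff, Finset.mem_singleton,
        Set.mem_empty_iff_false, iff_false, not_and]
      intro hab h
      have := h a (.inl rfl)
      have := h b (.inr rfl)
      exact hab.ne (by simp_all)
  rw [Finset.sum_singleton] at h
  omega

theorem internal_le_dksOpt (I : BudgetedGraph) {U : Finset (Fin I.n)} (h : U.card = I.k) :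
    I.internal U ≤ I.dksOpt :=
  Finset.le_sup (f := I.internal) (by simpa using h)

theorem exists_internal_eq_dksOpt (I : BudgetedGraph) :
    ∃ U : Finset (Fin I.n), U.card = I.k ∧ I.internal U = I.dksOpt := by
  obtain ⟨U, hU, h⟩ := Finset.exists_mem_eq_sup (Finset.univ.powersetCard I.k)
    (Finset.powersetCard_nonempty.2 (by simpa using I.k_le)) I.internal
  exact ⟨U, by simpa using hU, h.symm⟩

theorem fcecOpt_le_touching (I : BudgetedGraph) {U : Finset (Fin I.n)} (h : I.k ≤ U.card) :
    I.fcecOpt ≤ I.touching U :=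
  Nat.sInf_le ⟨U, h, rfl⟩

/-- Passing to a subset of exactly k vertices does not increase t, so "at least k" costs nothing
against "exactly k". -/
theorem exists_touching_eq_fcecOpt (I : BudgetedGraph) :
    ∃ U : Finset (Fin I.n), U.card = I.k ∧ I.touching U = I.fcecOpt := by
  obtain ⟨U, hU, h⟩ := Nat.sInf_mem (s := {t | ∃ U : Finset (Fin I.n), I.k ≤ U.card ∧
    I.touching U = t}) ⟨_, Finset.univ, by simpa using I.k_le, rfl⟩
  obtain ⟨V, hVU, hV⟩ := Finset.exists_subset_card_eq hU
  exact ⟨V, hV, le_antisymm ((I.touching_mono hVU).trans h.le) (I.fcecOpt_le_touching hV.ge)⟩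

theorem touching_add_internal_of_deg_eq (I : BudgetedGraph) {d : ℕ} {U : Finset (Fin I.n)}
    (h : ∀ v ∈ U, I.deg v = d) : I.touching U + I.internal U = d * U.card := by
  rw [touching_add_internal, Finset.sum_congr rfl h, Finset.sum_const, smul_eq_mul, mul_comm]

theorem fcecOpt_add_dksOpt_of_deg_eq (I : BudgetedGraph) {d : ℕ} (h : ∀ v, I.deg v = d) :
    I.fcecOpt + I.dksOpt = d * I.k := by
  obtain ⟨U, hU, hU'⟩ := I.exists_internal_eq_dksOpt
  obtain ⟨V, hV, hV'⟩ := I.exists_touching_eq_fcecOpt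
  have h₁ := I.touching_add_internal_of_deg_eq (U := U) fun v _ => h v
  have h₂ := I.touching_add_internal_of_deg_eq (U := V) fun v _ => h v
  have h₃ := I.fcecOpt_le_touching hU.ge
  have h₄ := I.internal_le_dksOpt hV
  rw [hU] at h₁
  rw [hV] at h₂
  omega

theorem touching_eq_fcecOpt_iff_of_deg_eq (I : BudgetedGraph) {d : ℕ} (h : ∀ v, I.deg v = d)
    {U : Finset (Fin I.n)} (hU : U.card = I.k) :
    I.touching U = I.fcecOpt ↔ I.internal U = I.dksOpt := by
  have h₁ := I.touching_add_internal_of_deg_eq (U := U) fun v _ => h v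
  have h₂ := I.fcecOpt_add_dksOpt_of_deg_eq h
  rw [hU] at h₁
  omega

/-! ### Making all degrees equal -/

/-- The number of new vertices for every old vertex in `padded`. -/
noncomputable def width (I : BudgetedGraph) : ℕ := Finset.univ.sup fun v => I.deg v + 1

theorem deg_lt_width (I : BudgetedGraph) (v : Fin I.n) : I.deg v + 1 ≤ I.width :=
  Finset.le_sup (f := fun v => I.deg v + 1) (Finset.mem_univ v)

/-- Without vertices the supremum is 0 and the equation fails. -/
theorem width_eq (I : BudgetedGraph) (h : 0 < I.n) : I.width = I.maxDeg + 1 := by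
  have : Nonempty (Fin I.n) := ⟨⟨0, h⟩⟩
  refine le_antisymm (Finset.sup_le fun v hv => ?_) ?_
  · exact Nat.succ_le_succ (Finset.le_sup (f := I.deg) hv)
  · obtain ⟨v, -, hv⟩ := Finset.exists_mem_eq_sup Finset.univ Finset.univ_nonempty I.deg
    rw [maxDeg, hv]
    exact I.deg_lt_width v

theorem deg_lt (I : BudgetedGraph) (v : Fin I.n) : I.deg v < I.n := by
  classical
  rw [deg, ← SimpleGraph.coe_neighborFinset, Set.ncard_coe_finset,
    SimpleGraph.card_neighborFinset_eq_degree]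
  simpa using I.G.degree_lt_card_verts v

theorem width_le (I : BudgetedGraph) : I.width ≤ I.n :=
  Finset.sup_le fun v _ => I.deg_lt v

/-- The graph of `padded`: the vertex `(v, 0)` stands for `v`, the other vertices form a clique,
and the vertex `(v, 0)` is joined to as many vertices `(v, j)`, `0 < j`, as are needed to bring its
degree up to the maximum degree. -/
noncomputable def paddedGraph (I : BudgetedGraph) : SimpleGraph (Fin I.n × Fin (I.width + 1)) where
  Adj x y :=
    if x.2 = 0 then
      if y.2 = 0 then I.G.Adj x.1 y.1 else x.1 = y.1 ∧ (y.2 : ℕ) + (I.deg x.1 + 1) ≤ I.width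
    else
      if y.2 = 0 then x.1 = y.1 ∧ (x.2 : ℕ) + (I.deg x.1 + 1) ≤ I.width else x ≠ y
  symm := ⟨fun x y h => by
    by_cases hx : x.2 = 0 <;> by_cases hy : y.2 = 0 <;> simp only [hx, hy, if_true, if_false] at h ⊢
    · exact h.symm
    · exact ⟨h.1.symm, h.1 ▸ h.2⟩
    · exact ⟨h.1.symm, h.1 ▸ h.2⟩
    · exact h.symm⟩
  loopless := ⟨fun x h => by by_cases hx : x.2 = 0 <;> simp [hx] at h⟩

/-- The input with additional vertices that make the degrees of all old vertices equal and that are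
too expensive to be chosen. -/
noncomputable def padded (I : BudgetedGraph) : BudgetedGraph where
  n := I.n * (I.width + 1)
  G := I.paddedGraph.comap finProdFinEquiv.symm
  k := I.k
  k_le := I.k_le.trans (Nat.le_mul_of_pos_right _ (Nat.succ_pos _))

/-- The numbering of the vertices of `padded`. -/
noncomputable def paddedEquiv (I : BudgetedGraph) :
    Fin I.n × Fin (I.width + 1) ≃ Fin I.padded.n := finProdFinEquiv

theorem adj_paddedEquiv (I : BudgetedGraph) (x y : Fin I.n × Fin (I.width + 1)) :
    I.padded.G.Adj (I.paddedEquiv x) (I.paddedEquiv y) ↔ I.paddedGraph.Adj x y := by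
  change I.paddedGraph.Adj (I.paddedEquiv.symm _) (I.paddedEquiv.symm _) ↔ _
  simp

theorem deg_padded (I : BudgetedGraph) (x : Fin I.n × Fin (I.width + 1)) :
    I.padded.deg (I.paddedEquiv x) = (I.paddedGraph.neighborSet x).ncard := by
  rw [deg, ← Set.ncard_image_of_injective (I.paddedGraph.neighborSet x) I.paddedEquiv.injective]
  congr 1
  ext i
  obtain ⟨y, rfl⟩ := I.paddedEquiv.surjective i
  rw [Function.Injective.mem_set_image I.paddedEquiv.injective]
  exact I.adj_paddedEquiv x y

/-- The old neighbours number deg(v), and the new ones are the indices j with 0 < j ≤ width -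
(deg(v) + 1). -/
theorem deg_padded_old (I : BudgetedGraph) (v : Fin I.n) :
    I.padded.deg (I.paddedEquiv (v, 0)) = I.width - 1 := by
  classical
  have h : I.paddedGraph.neighborSet (v, 0) = ((fun u => (u, 0)) '' I.G.neighborSet v) ∪
      ((fun j => (v, j)) '' ((Finset.univ.filter fun j : Fin (I.width + 1) =>
        j ≠ 0 ∧ (j : ℕ) + (I.deg v + 1) ≤ I.width : Finset _) : Set (Fin (I.width + 1)))) := by
    ext ⟨u, j⟩
    by_cases hj : j = 0
    · simp [paddedGraph, hj]
    · simp [paddedGraph, hj, Ne.symm hj, and_comm]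
  have hv := I.deg_lt_width v
  rw [deg_padded, h, Set.ncard_union_eq, Set.ncard_image_of_injective, Set.ncard_image_of_injective,
    Set.ncard_coe_finset]
  · have : (Finset.univ.filter fun j : Fin (I.width + 1) =>
        j ≠ 0 ∧ (j : ℕ) + (I.deg v + 1) ≤ I.width).map Fin.valEmbedding =
        Finset.Ioc 0 (I.width - (I.deg v + 1)) := by
      ext i
      simp only [Finset.mem_map, Finset.mem_filter, Finset.mem_univ, true_and,
        Fin.valEmbedding_apply, Finset.mem_Ioc, ne_eq, Fin.ext_iff, Fin.val_zero]
      constructor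
      · rintro ⟨j, hj, rfl⟩
        omega
      · intro hi
        exact ⟨⟨i, by omega⟩, ⟨by simp; omega, by simp; omega⟩, rfl⟩
    rw [← Finset.card_map Fin.valEmbedding, this, Nat.card_Ioc]
    change I.deg v + _ = _
    omega
  · exact fun i j h => (Prod.ext_iff.1 h).2
  · exact fun i j h => (Prod.ext_iff.1 h).1
  · rw [Set.disjoint_left]
    rintro _ ⟨u, -, rfl⟩ ⟨j, hj, h⟩
    simp at hj
    exact hj.1 (Prod.ext_iff.1 h).2

/-- The bound counts only the other members of the clique of new vertices. -/
theorem le_deg_padded_new (I : BudgetedGraph) {x : Fin I.n × Fin (I.width + 1)} (hx : x.2 ≠ 0) :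
    I.n * I.width - 1 ≤ I.padded.deg (I.paddedEquiv x) := by
  classical
  have h : ((((Finset.univ : Finset (Fin I.n)) ×ˢ
      ((Finset.univ : Finset (Fin (I.width + 1))).erase 0)).erase x : Finset _) : Set _) ⊆
      I.paddedGraph.neighborSet x := by
    intro y hy
    simp only [Finset.coe_erase, Finset.coe_product, Set.mem_sdiff, Set.mem_prod,
      Set.mem_singleton_iff, Finset.coe_univ, Set.mem_univ, true_and] at hy
    simp [paddedGraph, hx, hy.1, Ne.symm hy.2]
  rw [deg_padded]
  refine le_trans (le_of_eq ?_) (Set.ncard_le_ncard h (Set.toFinite _))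
  rw [Set.ncard_coe_finset, Finset.card_erase_of_mem (by simp [hx]), Finset.card_product,
    Finset.card_erase_of_mem (Finset.mem_univ _)]
  simp

/-- The embedding of the old vertices. -/
noncomputable def oldVertex (I : BudgetedGraph) : Fin I.n ↪ Fin I.padded.n :=
  ⟨fun v => I.paddedEquiv (v, 0), fun _ _ h => (Prod.ext_iff.1 (I.paddedEquiv.injective h)).1⟩

theorem adj_oldVertex (I : BudgetedGraph) (u v : Fin I.n) :
    I.padded.G.Adj (I.oldVertex u) (I.oldVertex v) ↔ I.G.Adj u v := by
  refine (I.adj_paddedEquiv _ _).trans ?_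
  simp [paddedGraph]

theorem internal_padded (I : BudgetedGraph) (U : Finset (Fin I.n)) :
    I.padded.internal (U.map I.oldVertex) = I.internal U := by
  rw [internal, internal, ← Set.ncard_image_of_injective _ (Sym2.map.injective I.oldVertex.injective)]
  congr 1
  ext e
  constructor
  · induction e using Sym2.ind with
    | _ a b =>
      rintro ⟨hab, h⟩
      obtain ⟨a, ha, rfl⟩ := Finset.mem_map.1 (h a (Sym2.mem_mk_left _ _))
      obtain ⟨b, hb, rfl⟩ := Finset.mem_map.1 (h b (Sym2.mem_mk_right _ _))
      exact ⟨s(a, b), ⟨(I.adj_oldVertex a b).1 hab, by simp [ha, hb]⟩, rfl⟩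
  · rintro ⟨e, ⟨he, h⟩, rfl⟩
    induction e using Sym2.ind with
    | _ a b =>
      simp only [Sym2.mem_iff, forall_eq_or_imp, forall_eq] at h
      exact ⟨(I.adj_oldVertex a b).2 he, by simp [h]⟩

theorem touching_padded_add_internal (I : BudgetedGraph) (U : Finset (Fin I.n)) :
    I.padded.touching (U.map I.oldVertex) + I.internal U = (I.width - 1) * U.card := by
  rw [← internal_padded, ← Finset.card_map I.oldVertex]
  refine I.padded.touching_add_internal_of_deg_eq fun v hv => ?_
  obtain ⟨v, -, rfl⟩ := Finset.mem_map.1 hv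
  exact I.deg_padded_old v

/-- The gap argument: t(U) ≤ Δk - OPT/2 is too small for U to contain a new vertex, and it forces
e(V) = Δk - t(V) ≥ OPT/2 for each V in U of size k. -/
theorem dksOpt_le_two_mul_internal {a b : ℝ} (ha : 0 < a) (hb : 0 < b) {I : BudgetedGraph}
    (hI : IsModifiedInstance a b I) {U : Finset (Fin I.padded.n)}
    (hUt : (I.padded.touching U : ℝ) ≤ (1 + a / (4 * b)) * I.padded.fcecOpt) :
    (∃ V : Finset (Fin I.n), U = V.map I.oldVertex) ∧
      ∀ V : Finset (Fin I.n), V.map I.oldVertex ⊆ U → V.card = I.k →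
        (I.dksOpt : ℝ) ≤ 2 * I.internal V := by
  -- The empty graph is set apart because `width_eq` and the positivity of OPT need a vertex.
  rcases Nat.eq_zero_or_pos I.n with hn | hn
  · have : IsEmpty (Fin I.n) := by rw [hn]; infer_instance
    have hp : I.padded.n = 0 := by simp [padded, hn]
    have : IsEmpty (Fin I.padded.n) := by rw [hp]; infer_instance
    refine ⟨⟨∅, Subsingleton.elim _ _⟩, fun V _ hV => ?_⟩
    obtain ⟨W, hW, h⟩ := I.exists_internal_eq_dksOpt
    rw [← h, Subsingleton.elim W V]
    have : (0 : ℝ) ≤ I.internal V := Nat.cast_nonneg _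
    linarith
  obtain ⟨S, hS, hS'⟩ := I.exists_internal_eq_dksOpt
  have h₁ := I.touching_padded_add_internal S
  have h₂ : I.padded.fcecOpt ≤ I.padded.touching (S.map I.oldVertex) :=
    I.padded.fcecOpt_le_touching (by rw [Finset.card_map, hS]; rfl)
  have hw := I.width_eq hn
  rw [hw, Nat.add_sub_cancel, hS, hS'] at h₁
  have h₃ : (I.padded.fcecOpt : ℝ) + I.dksOpt ≤ I.maxDeg * I.k := by
    exact_mod_cast (by omega : I.padded.fcecOpt + I.dksOpt ≤ I.maxDeg * I.k)
  have hn' : (0 : ℝ) < I.n := by exact_mod_cast hn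
  have hr : (0 : ℝ) < (I.n : ℝ) ^ (1 / 3 : ℝ) := Real.rpow_pos_of_pos hn' _
  have hk : (0 : ℝ) < I.k :=
    lt_of_lt_of_le (mul_pos ha (Real.rpow_pos_of_pos hn' _)) hI.k_lower
  have h₄ : a * (I.n : ℝ) ^ (1 / 3 : ℝ) * I.k ≤ 2 * I.dksOpt := (le_div_iff₀ hk).1 hI.avgDeg_lower
  have hd : (0 : ℝ) < I.dksOpt := by
    have := mul_pos (mul_pos ha hr) hk
    linarith
  -- The choice of ε: the factor b cancels the bound on Δ, and a n^{1/3} k ≤ 2 OPT leaves OPT/2.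
  have h₅ : a / (4 * b) * (I.maxDeg * I.k) ≤ I.dksOpt / 2 := by
    have : a / (4 * b) * (I.maxDeg * I.k) ≤
        a / (4 * b) * (b * (I.n : ℝ) ^ (1 / 3 : ℝ) * I.k) := by
      gcongr
      exact hI.maxDeg_upper
    have e : a / (4 * b) * (b * (I.n : ℝ) ^ (1 / 3 : ℝ) * I.k) =
        a * (I.n : ℝ) ^ (1 / 3 : ℝ) * I.k / 4 := by
      field_simp
    linarith
  have h₆ : (I.padded.touching U : ℝ) ≤ I.maxDeg * I.k - I.dksOpt / 2 := by
    have hε : 0 < a / (4 * b) := by positivity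
    have : a / (4 * b) * I.padded.fcecOpt ≤ a / (4 * b) * (I.maxDeg * I.k) := by
      gcongr
      linarith
    linarith
  constructor
  · refine ⟨Finset.univ.filter fun v => I.oldVertex v ∈ U, ?_⟩
    ext i
    constructor
    · intro hi
      obtain ⟨⟨v, j⟩, rfl⟩ := I.paddedEquiv.surjective i
      have hj : j = 0 := by
        by_contra hj
        -- A new vertex would give t(U) ≥ n(Δ + 1) - 1 ≥ Δk, against t(U) < Δk, which is strict
        -- because OPT > 0.
        have h₇ := (I.le_deg_padded_new (x := (v, j)) hj).trans (I.padded.deg_le_touching hi)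
        have h₈ : I.padded.touching U < I.maxDeg * I.k := by
          exact_mod_cast (by linarith : (I.padded.touching U : ℝ) < I.maxDeg * I.k)
        have h₉ : I.maxDeg * I.k ≤ I.maxDeg * I.n := Nat.mul_le_mul_left _ I.k_le
        have h₀ : I.n * (I.maxDeg + 1) = I.maxDeg * I.n + I.n := by ring
        rw [hw, h₀] at h₇
        omega
      subst hj
      exact Finset.mem_map.2 ⟨v, Finset.mem_filter.2 ⟨Finset.mem_univ _, hi⟩, rfl⟩
    · intro hi
      obtain ⟨v, hv, rfl⟩ := Finset.mem_map.1 hi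
      exact (Finset.mem_filter.1 hv).2
  · intro V hVU hV
    have h₇ := I.padded.touching_mono hVU
    have h₈ := I.touching_padded_add_internal V
    rw [hw, Nat.add_sub_cancel, hV] at h₈
    have h₉ : (I.maxDeg * I.k : ℝ) ≤ I.padded.touching U + I.internal V := by
      exact_mod_cast (by omega : I.maxDeg * I.k ≤ I.padded.touching U + I.internal V)
    linarith

end BudgetedGraph

/-! ### Programs with named stacks -/

/-- The names of the stacks. -/
inductive Reg
  | inp | mid | res | a | a' | n | n' | q | q' | k | k' | z | c | c' | r | r'
  deriving DecidableEq

instance : Fintype Reg where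
  elems := {.inp, .mid, .res, .a, .a', .n, .n', .q, .q', .k, .k', .z, .c, .c', .r, .r'}
  complete x := by cases x <;> decide

/-- The contents of the stacks. -/
@[ext] structure Mem where
  inp : List Bool := []
  mid : List Bool := []
  res : List Bool := []
  a : List Bool := []
  a' : List Bool := []
  n : List Bool := []
  n' : List Bool := []
  q : List Bool := []
  q' : List Bool := []
  k : List Bool := []
  k' : List Bool := []
  z : List Bool := []
  c : List Bool := []
  c' : List Bool := []
  r : List Bool := []
  r' : List Bool := []

namespace Mem

/-- Read a stack. -/
def get (s : Mem) : Reg → List Bool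
  | .inp => s.inp | .mid => s.mid | .res => s.res | .a => s.a | .a' => s.a' | .n => s.n
  | .n' => s.n' | .q => s.q | .q' => s.q' | .k => s.k | .k' => s.k' | .z => s.z | .c => s.c
  | .c' => s.c' | .r => s.r | .r' => s.r'

/-- Replace the contents of a stack. -/
def set (s : Mem) (j : Reg) (l : List Bool) : Mem :=
  match j with
  | .inp => { s with inp := l } | .mid => { s with mid := l } | .res => { s with res := l }
  | .a => { s with a := l } | .a' => { s with a' := l } | .n => { s with n := l }
  | .n' => { s with n' := l } | .q => { s with q := l } | .q' => { s with q' := l }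
  | .k => { s with k := l } | .k' => { s with k' := l } | .z => { s with z := l }
  | .c => { s with c := l } | .c' => { s with c' := l } | .r => { s with r := l }
  | .r' => { s with r' := l }

theorem get_set (s : Mem) (j : Reg) (l : List Bool) :
    (s.set j l).get = Function.update s.get j l := by
  funext i
  cases j <;> cases i <;> rfl

theorem get_injective : Function.Injective get := by
  intro s s' h
  ext1
  exacts [congrFun h .inp, congrFun h .mid, congrFun h .res, congrFun h .a, congrFun h .a',
    congrFun h .n, congrFun h .n', congrFun h .q, congrFun h .q', congrFun h .k, congrFun h .k',
    congrFun h .z, congrFun h .c, congrFun h .c', congrFun h .r, congrFun h .r']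

theorem get_set_self (s : Mem) (j : Reg) (l : List Bool) : (s.set j l).get j = l := by
  rw [get_set, Function.update_self]

theorem get_set_of_ne (s : Mem) {i j : Reg} (h : i ≠ j) (l : List Bool) :
    (s.set j l).get i = s.get i := by
  rw [get_set, Function.update_of_ne h]

theorem set_set (s : Mem) (j : Reg) (l l' : List Bool) : (s.set j l).set j l' = s.set j l' := by
  cases j <;> rfl

theorem set_comm (s : Mem) {i j : Reg} (h : i ≠ j) (l l' : List Bool) :
    (s.set i l).set j l' = (s.set j l').set i l :=
  get_injective (by simp only [get_set]; exact Function.update_comm h _ _ _)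

theorem set_get (s : Mem) (j : Reg) : s.set j (s.get j) = s := by
  cases j <;> rfl

end Mem

/-- A number in unary. -/
abbrev ones (m : ℕ) : List Bool := List.replicate m true

theorem cons_ones (m : ℕ) : true :: ones m = ones (m + 1) := rfl

theorem ones_append (m m' : ℕ) : ones m ++ ones m' = ones (m + m') :=
  List.replicate_append_replicate

theorem reverse_ones (m : ℕ) : (ones m).reverse = ones m := List.reverse_replicate ..

namespace Cmd

/-- The command `c` turns the memory `s` into `s'` in time at most `t`. -/
def Ex (c : Cmd Reg) (s s' : Mem) (t : ℕ) : Prop := Exec c s.get s'.get t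

variable {s s' s'' : Mem} {t t' : ℕ}

theorem Ex.of_eq {c : Cmd Reg} (h : c.Ex s s' t) (hs : s' = s'') (ht : t ≤ t') :
    c.Ex s s'' t' :=
  hs ▸ Exec.mono h ht

theorem Ex.congr_left {c : Cmd Reg} {s₁ s₂ : Mem} (h : c.Ex s₁ s' t) (hs : s₁ = s₂) :
    c.Ex s₂ s' t :=
  hs ▸ h

theorem Ex.seq {c₁ c₂ : Cmd Reg} (h₁ : c₁.Ex s s' t) (h₂ : c₂.Ex s' s'' t') :
    (c₁.seq c₂).Ex s s'' (t + t') :=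
  Exec.seq h₁ h₂

theorem ex_skip (s : Mem) : (skip : Cmd Reg).Ex s s 1 := Exec.skip _

theorem ex_push (j : Reg) (b : Bool) (s : Mem) : (push j b).Ex s (s.set j (b :: s.get j)) 1 := by
  rw [Ex, Mem.get_set]
  exact Exec.push _ _ _

/-- Pop a symbol and continue with a program that depends on it. -/
def pop (j : Reg) (c : Option Bool → Cmd Reg) : Cmd Reg := .test j c fun _ => false

theorem Ex.pop {j : Reg} {c : Option Bool → Cmd Reg} {o : Option Bool} {l : List Bool}
    (ho : (s.get j).head? = o) (hl : (s.get j).tail = l) (h : (c o).Ex (s.set j l) s' t) :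
    (pop j c).Ex s s' (t + 1) := by
  subst ho hl
  refine Exec.test_exit rfl ?_
  rw [← Mem.get_set]
  exact h

/-- Pop all symbols of a stack and run a program for each of them. -/
def loop (j : Reg) (c : Bool → Cmd Reg) : Cmd Reg :=
  .test j (fun o => o.elim skip c) Option.isSome

/-- The loop rule: `F p l` is the invariant memory when `p` has been processed and `l` remains. The
list may carry more information than the bits `φ` on the stack. -/
theorem Ex.loop {α : Type*} {j : Reg} {c : Bool → Cmd Reg} (φ : α → Bool) (L : List α)
    (F : List α → List α → Mem) (hget : ∀ p l, p ++ l = L → (F p l).get j = l.map φ)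
    (h : ∀ p x l, p ++ x :: l = L →
      (c (φ x)).Ex ((F p (x :: l)).set j (l.map φ)) (F (p ++ [x]) l) t) :
    (loop j c).Ex (F [] L) (F L []) (L.length * (t + 1) + 2) := by
  suffices ∀ l p, p ++ l = L → (Cmd.loop j c).Ex (F p l) (F L []) (l.length * (t + 1) + 2) from
    this L [] rfl
  intro l
  induction l with
  | nil =>
    intro p hp
    rw [List.append_nil] at hp
    subst hp
    have hg : (F p []).get j = [] := hget p [] (by simp)
    -- The 2 in the bound is the last, failed pop and the `skip` after it.
    refine Exec.mono (Exec.test_exit (t := 1) (by rw [hg]; rfl) ?_) (by simp)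
    rw [← Mem.get_set, hg]
    have : (F p []).set j [] = F p [] := by rw [← hg, Mem.set_get]
    exact this.symm ▸ Exec.skip _
  | cons x l ih =>
    intro p hp
    have hg := hget p (x :: l) hp
    have h₁ := h p x l hp
    have h₂ := ih (p ++ [x]) (by simpa using hp)
    rw [Ex, Mem.get_set] at h₁
    refine Exec.mono (Exec.test_again (by rw [hg]; rfl) (by rw [hg]; exact h₁) h₂) ?_
    simp only [List.length_cons]
    linarith

/-- Pop ones until another symbol is found, and run a program for each of them. -/
def whileOne (j : Reg) (c : Cmd Reg) : Cmd Reg :=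
  .test j (fun o => bif o == some true then c else skip) (· == some true)

/-- Here `F i` is the memory after `i` passes. The terminating `false` is consumed as well. -/
theorem Ex.whileOne {j : Reg} {c : Cmd Reg} (m : ℕ) (F : ℕ → Mem) (rest : List Bool)
    (hget : ∀ i ≤ m, (F i).get j = ones (m - i) ++ false :: rest)
    (h : ∀ i < m, c.Ex ((F i).set j (ones (m - (i + 1)) ++ false :: rest)) (F (i + 1)) t) :
    (whileOne j c).Ex (F 0) ((F m).set j rest) (m * (t + 1) + 2) := by
  suffices ∀ d i, i + d = m →
      (Cmd.whileOne j c).Ex (F i) ((F m).set j rest) (d * (t + 1) + 2) from this m 0 (by simp)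
  intro d
  induction d with
  | zero =>
    intro i hi
    obtain rfl : i = m := by simpa using hi
    have hg : (F i).get j = false :: rest := by simpa using hget i le_rfl
    refine Exec.mono (Exec.test_exit (t := 1) (by rw [hg]; rfl) ?_) (by simp)
    rw [hg, ← Mem.get_set]
    exact Exec.skip _
  | succ d ih =>
    intro i hi
    have hg := hget i (by omega)
    have h₁ := h i (by omega)
    rw [Ex, Mem.get_set] at h₁
    rw [show m - i = m - (i + 1) + 1 by omega] at hg
    refine Exec.mono (Exec.test_again (by rw [hg]; rfl) (by rw [hg]; exact h₁)
      (ih (i + 1) (by omega))) ?_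
    linarith

/-- Move the contents of the stack `j` to the stack `j'`, reversing their order. -/
def move (j j' : Reg) : Cmd Reg := loop j fun b => push j' b

theorem ex_move {j j' : Reg} (hj : j ≠ j') (s : Mem) :
    (move j j').Ex s ((s.set j []).set j' ((s.get j).reverse ++ s.get j'))
      ((s.get j).length * 2 + 2) := by
  have := Ex.loop (t := 1) (j := j) (c := fun b => push j' b) id (s.get j)
    (fun p l => (s.set j l).set j' (p.reverse ++ s.get j')) (fun p l _ => by
      rw [Mem.get_set_of_ne _ hj, Mem.get_set_self, List.map_id]) (fun p x l _ => by
      refine (ex_push j' x _).of_eq ?_ le_rfl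
      rw [Mem.get_set_of_ne _ hj.symm, Mem.get_set_self, Mem.set_comm _ hj.symm, Mem.set_set,
        Mem.set_set, List.map_id]
      simp)
  refine Eq.mp ?_ this
  simp only [Mem.set_get, List.reverse_nil, List.nil_append]
  rfl

/-- Run a program as often as the number in the stack `j` says; the number in the stack `j'` counts
how often it has been run. -/
def count (j j' : Reg) (c : Cmd Reg) : Cmd Reg :=
  (loop j fun _ => c.seq (push j' true)).seq (move j' j)

/-- During a pass `j` holds the number of items still to come and `j'` the number already done, so
the body can read its own position; later this locates the diagonal of the matrix. At the end the
counter is restored. -/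
theorem Ex.count {α : Type*} {j j' : Reg} (hj : j ≠ j') {c : Cmd Reg} (L : List α)
    (F : List α → List α → Mem) (h : ∀ p x l, p ++ x :: l = L →
      c.Ex (((F p (x :: l)).set j (ones l.length)).set j' (ones p.length))
        (((F (p ++ [x]) l).set j (ones l.length)).set j' (ones p.length)) t)
    (h₀ : ((F [] L).set j (ones L.length)).set j' [] = s)
    (h₁ : ((F L []).set j (ones L.length)).set j' [] = s') :
    (count j j' c).Ex s s' (L.length * (t + 4) + 4) := by
  subst h₀ h₁
  have h₂ := Ex.loop (t := t + 1) (j := j) (c := fun _ => c.seq (push j' true)) (fun _ => true) L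
    (fun p l => ((F p l).set j (ones l.length)).set j' (ones p.length)) (fun p l _ => by
      rw [Mem.get_set_of_ne _ hj, Mem.get_set_self, List.map_const']) (fun p x l hp => by
      have := (h p x l hp).seq (ex_push j' true _)
      refine Eq.mp ?_ this
      rw [Mem.set_set, Mem.get_set_self, Mem.set_comm _ hj.symm, Mem.set_set, cons_ones,
        List.length_append, List.length_singleton, List.map_const'])
  refine (h₂.seq (ex_move hj.symm _)).of_eq ?_ ?_
  · rw [Mem.get_set_self, Mem.set_set, Mem.get_set_of_ne _ hj, Mem.get_set_self,
      Mem.set_comm _ hj.symm, Mem.set_set]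
    simp
  · rw [Mem.get_set_self, List.length_replicate]
    linarith

end Cmd

namespace Cmd

variable {s s' s'' : Mem} {t t' : ℕ}

/-- Write a bit as often as the number in `j` says. -/
def fill (j j' : Reg) (b : Bool) : Cmd Reg := count j j' (push .mid b)

theorem ex_fill {j j' : Reg} (hj : j ≠ j') (h : j ≠ .mid) (h' : j' ≠ .mid) (b : Bool) {m : ℕ}
    (hm : s.get j = ones m) (hm' : s.get j' = []) :
    (fill j j' b).Ex s (s.set .mid (List.replicate m b ++ s.mid)) (m * 5 + 4) := by
  have := Ex.count (t := 1) hj (c := push .mid b) (List.range m)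
    (fun p _ => s.set .mid (List.replicate p.length b ++ s.mid)) (fun p x l _ => by
      refine (ex_push _ _ _).of_eq ?_ le_rfl
      rw [Mem.get_set_of_ne _ h'.symm, Mem.get_set_of_ne _ h.symm, Mem.get_set_self,
        Mem.set_comm _ h', Mem.set_comm _ h, Mem.set_set]
      simp [List.replicate_succ]) rfl rfl
  rw [List.length_range] at this
  refine Eq.mp ?_ this
  congr 1
  · change ((s.set .mid (s.get .mid)).set j (ones m)).set j' [] = s
    rw [Mem.set_get, ← hm, Mem.set_get, ← hm', Mem.set_get]
  · rw [Mem.set_comm _ h.symm, Mem.set_comm _ h'.symm, ← hm, Mem.set_get, ← hm', Mem.set_get]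

/-! #### Scanning a row -/

/-- Decrement the number in `q` and increment the number in `z`. -/
def shift : Cmd Reg := (pop .q fun _ => skip).seq (push .z true)

/-- Popping an empty stack leaves it empty, in agreement with truncated subtraction. -/
theorem ex_shift {w m : ℕ} (hq : s.q = ones w) (hz : s.z = ones m) :
    shift.Ex s { s with q := ones (w - 1), z := ones (m + 1) } 3 := by
  refine Ex.of_eq (Ex.seq (Ex.pop rfl (l := ones (w - 1)) ?_ (ex_skip _)) (ex_push _ _ _)) ?_ le_rfl
  · change s.q.tail = _
    rw [hq, List.tail_replicate]
  · simp [Mem.set, Mem.get, hz, List.replicate_succ]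

/-- Read a bit of the input. -/
def scanBit : Cmd Reg :=
  pop .inp fun o => o.elim skip fun b => (push .r' b).seq (bif b then shift else skip)

theorem ex_scanBit {w m : ℕ} {b : Bool} {l : List Bool} (hi : s.inp = b :: l) (hq : s.q = ones w)
    (hz : s.z = ones m) :
    scanBit.Ex s { s with
      inp := l
      r' := b :: s.r'
      q := ones (w - b.toNat)
      z := ones (m + b.toNat) } 5 := by
  refine Ex.pop (o := some b) (l := l) (t := 4) ?_ ?_ ?_
  · simp [Mem.get, hi]
  · simp [Mem.get, hi]
  · cases b
    · refine Ex.of_eq (Ex.seq (ex_push _ _ _) (ex_skip _)) ?_ (by norm_num)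
      simp [Mem.set, Mem.get, hz, hq]
    · exact Ex.of_eq (Ex.seq (ex_push _ _ _) (ex_shift (w := w) (m := m) hq hz)) rfl le_rfl

/-- Read a row of the adjacency matrix, and move one plus the degree from `q` to `z`. -/
def scan : Cmd Reg := shift.seq (count .n .n' scanBit)

theorem ex_scan {w : ℕ} {row rest : List Bool} (hi : s.inp = row ++ rest)
    (hn : s.n = ones row.length) (hn' : s.n' = []) (hq : s.q = ones w) (hz : s.z = []) :
    scan.Ex s { s with
      inp := rest
      r' := row.reverse ++ s.r'
      q := ones (w - (row.count true + 1))
      z := ones (row.count true + 1) }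
      (row.length * 9 + 7) := by
  refine Ex.of_eq (Ex.seq (ex_shift (w := w) (m := 0) hq hz) (Ex.count (t := 5) (by decide) row
    (fun p l => { s with
      inp := l ++ rest
      r' := p.reverse ++ s.r'
      q := ones (w - (p.count true + 1))
      z := ones (p.count true + 1) })
    (fun p x l hp => ?_) ?_ rfl)) ?_ (by linarith)
  · refine Ex.of_eq (ex_scanBit (b := x) (l := l ++ rest) (w := w - (p.count true + 1))
      (m := p.count true + 1) rfl rfl rfl) ?_ le_rfl
    cases x <;> simp [Mem.set, Nat.sub_sub, add_assoc]
  · simp [Mem.set, hi, hn, hn']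
  · simp [Mem.set, hn, hn']

/-! #### The width -/

/-- Compute the width. -/
def findWidth : Cmd Reg := (count .a .a' (scan.seq (move .z .q))).seq (move .r' .inp)

/-- A maximum without comparison: scanning a row turns `q` from w into the truncated w - m and `z`
into m = degree + 1, and (w - m) + m = max w m. The rows are collected backwards in `r'` and finally
put back into `inp`. -/
theorem ex_findWidth {α : Type*} (L : List α) (f : α → List Bool) (N : ℕ)
    (hf : ∀ x, (f x).length = N) (W : List α → ℕ) (hW : W [] = 0)
    (hW' : ∀ p x, W (p ++ [x]) = max (W p) ((f x).count true + 1))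
    (hi : s.inp = L.flatMap f) (ha : s.a = ones L.length) (ha' : s.a' = []) (hn : s.n = ones N)
    (hn' : s.n' = []) (hq : s.q = []) (hz : s.z = []) (hr' : s.r' = []) :
    findWidth.Ex s { s with q := ones (W L) } (L.length * (N * 13 + 17) + 6) := by
  refine Ex.of_eq (Ex.seq (t := L.length * (N * 11 + 15) + 4)
    (s' := { s with inp := [], r' := (L.flatMap f).reverse, q := ones (W L) })
    (Ex.count (t := N * 11 + 11) (by decide) L
    (fun p l => { s with inp := l.flatMap f, r' := (p.flatMap f).reverse, q := ones (W p) })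
    (fun p x l hp => ?_) ?_ ?_) (ex_move (by decide) _)) ?_ ?_
  · have hc := (f x).count_le_length (a := true)
    rw [hf] at hc
    refine Ex.of_eq (Ex.seq (ex_scan (w := W p) (row := f x) (rest := l.flatMap f)
      (by simp [Mem.set]) (by simp [Mem.set, hn, hf]) hn' rfl hz) (ex_move (by decide) _)) ?_ ?_
    · simp only [Mem.set, Mem.get, reverse_ones, ones_append, hW', Mem.mk.injEq,
        List.flatMap_append, List.reverse_append, hz]
      simp
      omega
    · simp only [Mem.get, List.length_replicate, hf]
      omega
  · simp only [Mem.set, hW]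
    ext1 <;> simp [hi, ha, ha', hq, hr']
  · simp [Mem.set, ha, ha']
  · simp [Mem.set, Mem.get, hi, hr']
  · have : (L.flatMap f).length = L.length * N := by
      rw [List.length_flatMap, List.map_congr_left (fun x _ => hf x)]
      simp
    simp only [Mem.get, List.length_reverse, this]
    linarith

/-! #### Writing the rows -/

/-- Fill `c` with as many ones as the number in `q` says, followed by as many zeros as the number in
`z` says, and add `z` to `q`. -/
def build : Cmd Reg :=
  (loop .z fun _ => (push .c false).seq (push .q' true)).seq <|
    (loop .q fun _ => (push .c true).seq (push .q' true)).seq (move .q' .q)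

/-- With w = width - (degree + 1) and m = degree + 1, `c` becomes the adjacency pattern between an
old vertex and its own new vertices, and `q` is the width again. -/
theorem ex_build {w m : ℕ} (hq : s.q = ones w) (hz : s.z = ones m) (hc : s.c = [])
    (hq' : s.q' = []) :
    build.Ex s { s with z := [], c := ones w ++ List.replicate m false, q := ones (w + m) }
      ((w + m) * 5 + 6) := by
  have h₁ := Ex.loop (t := 2) (j := .z) (c := fun _ => (push .c false).seq (push .q' true))
    (fun _ => true) (List.range m)
    (fun p l => { s with
      z := ones l.length
      c := List.replicate p.length false
      q' := ones p.length }) (fun p l _ => by simp [Mem.get]) (fun p x l _ => by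
      refine ((ex_push _ _ _).seq (ex_push _ _ _)).of_eq ?_ le_rfl
      simp [Mem.get, Mem.set, List.replicate_succ])
  have h₂ := Ex.loop (t := 2) (j := .q) (c := fun _ => (push .c true).seq (push .q' true))
    (fun _ => true) (List.range w)
    (fun p l => { s with
      z := []
      c := ones p.length ++ List.replicate m false
      q := ones l.length
      q' := ones (p.length + m) }) (fun p l _ => by simp [Mem.get]) (fun p x l _ => by
      refine ((ex_push _ _ _).seq (ex_push _ _ _)).of_eq ?_ le_rfl
      simp [Mem.get, Mem.set, List.replicate_succ, Nat.add_right_comm])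
  have h₁' := h₁.congr_left (s₂ := s) (by ext1 <;> simp [hz, hc, hq'])
  have h₂' := h₂.congr_left (s₂ := { s with
      z := []
      c := List.replicate (List.range m).length false
      q' := ones (List.range m).length }) (by ext1 <;> simp [hq])
  refine Ex.of_eq (Ex.seq h₁' (Ex.seq h₂' (ex_move (by decide) _))) ?_ ?_
  · simp [Mem.get, Mem.set, hq']
  · simp [Mem.get]
    linarith

/-- Write an entry of the old adjacency matrix and zeros for the new vertices. -/
def oldCell : Cmd Reg := (pop .r fun o => o.elim skip fun b => push .mid b).seq (fill .q .q' false)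

theorem ex_oldCell {Q : ℕ} {b : Bool} {l : List Bool} (hq : s.q = ones Q) (hq' : s.q' = [])
    (hr : s.r = b :: l) :
    oldCell.Ex s { s with r := l, mid := (b :: List.replicate Q false).reverse ++ s.mid }
      (Q * 5 + 6) := by
  refine Ex.of_eq (Ex.seq (Ex.pop (o := some b) (l := l) ?_ ?_ (ex_push _ _ _))
    (ex_fill (m := Q) (by decide) (by decide) (by decide) _ hq hq')) ?_ (by linarith)
  · simp [Mem.get, hr]
  · simp [Mem.get, hr]
  · simp [Mem.get, Mem.set]

theorem ex_count_oldCell {j : Reg} (hj : j = .a ∨ j = .a') {Q : ℕ} {l₁ l₂ : List Bool}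
    (hl : s.get j = ones l₁.length) (hn' : s.n' = []) (hq : s.q = ones Q) (hq' : s.q' = [])
    (hr : s.r = l₁ ++ l₂) :
    (count j .n' oldCell).Ex s { s with
      r := l₂
      mid := (l₁.flatMap fun b => b :: List.replicate Q false).reverse ++ s.mid }
      (l₁.length * (Q * 5 + 10) + 4) := by
  refine Ex.of_eq (Ex.count (t := Q * 5 + 6) (by rcases hj with rfl | rfl <;> decide) l₁
    (fun p l => { s with
      r := l ++ l₂
      mid := (p.flatMap fun b => b :: List.replicate Q false).reverse ++ s.mid })
    (fun p x l _ => ?_) ?_ rfl) ?_ (by linarith)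
  · rcases hj with rfl | rfl
    · exact Ex.of_eq (ex_oldCell (Q := Q) (b := x) (l := l ++ l₂) hq hq' rfl) (by simp [Mem.set])
        le_rfl
    · exact Ex.of_eq (ex_oldCell (Q := Q) (b := x) (l := l ++ l₂) hq hq' rfl) (by simp [Mem.set])
        le_rfl
  · rcases hj with rfl | rfl
    · have : s.a = ones l₁.length := hl
      ext1 <;> simp [Mem.set, hr, this, hn']
    · have : s.a' = ones l₁.length := hl
      ext1 <;> simp [Mem.set, hr, this, hn']
  · rcases hj with rfl | rfl
    · have : s.a = ones l₁.length := hl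
      simp [Mem.set, this, hn']
    · have : s.a' = ones l₁.length := hl
      simp [Mem.set, this, hn']

/-- Write the row of an old vertex. -/
def oldRow : Cmd Reg :=
  (count .a' .n' oldCell).seq <| (pop .r fun o => o.elim skip fun b => push .mid b).seq <|
    ((loop .c fun b => (push .mid b).seq (push .c' b)).seq (move .c' .c)).seq <|
    count .a .n' oldCell

/-- The row is cut at the current vertex: `a'` counts the vertices before it, `a` those after it.
Only the block of the current vertex carries the pattern `c`; `c'` serves to restore `c` for the new
rows. -/
theorem ex_oldRow {Q : ℕ} {l₁ l₂ : List Bool} {b : Bool} (ha : s.a = ones l₂.length)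
    (ha' : s.a' = ones l₁.length) (hn' : s.n' = []) (hq : s.q = ones Q) (hq' : s.q' = [])
    (hr : s.r = l₁ ++ b :: l₂) (hc : s.c.length = Q) (hc' : s.c' = []) :
    oldRow.Ex s { s with
      r := []
      mid := ((l₁.flatMap fun b => b :: List.replicate Q false) ++ (b :: s.c) ++
        l₂.flatMap fun b => b :: List.replicate Q false).reverse ++ s.mid }
      ((l₁.length + l₂.length + 1) * (Q * 5 + 10) + 14) := by
  have h₁ := ex_count_oldCell (j := .a') (by simp) (Q := Q) (l₂ := b :: l₂) ha' hn' hq hq' hr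
  have h₂ := Ex.loop (t := 2) (j := .c) (c := fun b => (push .mid b).seq (push .c' b)) id s.c
    (fun p l => { s with
      r := l₂
      c := l
      c' := p.reverse
      mid := p.reverse ++ b :: ((l₁.flatMap fun b => b :: List.replicate Q false).reverse ++
        s.mid) }) (fun p l _ => by simp [Mem.get]) (fun p x l _ => by
      refine ((ex_push _ _ _).seq (ex_push _ _ _)).of_eq ?_ le_rfl
      simp [Mem.get, Mem.set])
  have h₃ := Ex.of_eq (h₂.seq (ex_move (j := .c') (j' := .c) (by decide) _)) (s'' := { s with
      r := l₂
      mid := s.c.reverse ++ b :: ((l₁.flatMap fun b => b :: List.replicate Q false).reverse ++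
        s.mid) }) (t' := Q * 5 + 4) (by simp [Mem.set, Mem.get, hc']) (by
          simp [Mem.get, hc]; linarith)
  have h₄ := h₃.congr_left (s₂ := { s with
      r := l₂
      mid := b :: ((l₁.flatMap fun b => b :: List.replicate Q false).reverse ++ s.mid) })
      (by ext1 <;> simp [hc'])
  refine Ex.of_eq (Ex.seq h₁ (Ex.seq (Ex.pop (o := some b) (l := l₂) rfl rfl (ex_push _ _ _))
    (Ex.seq h₄ (ex_count_oldCell (j := .a) (by simp) (Q := Q) (l₁ := l₂) (l₂ := []) ha hn' hq hq'
      (by simp))))) ?_ (by linarith)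
  simp

/-- Write as many ones as the number in `q'` says, the bit `b`, and as many ones as the number in
`q` says. -/
def split (b : Bool) : Cmd Reg :=
  (fill .q' .r' true).seq ((push .mid b).seq (fill .q .r' true))

theorem ex_split {w w' : ℕ} (b : Bool) (hq : s.q = ones w) (hq' : s.q' = ones w')
    (hr' : s.r' = []) :
    (split b).Ex s { s with mid := (ones w' ++ b :: ones w).reverse ++ s.mid }
      ((w' + w) * 5 + 9) := by
  refine Ex.of_eq (Ex.seq (ex_fill (m := w') (by decide) (by decide) (by decide) true hq' hr')
    (Ex.seq (ex_push _ _ _) (ex_fill (m := w) (by decide) (by decide) (by decide) true hq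
      hr'))) ?_ (by linarith)
  simp [Mem.set, Mem.get]

theorem ex_count_newCell {α : Type*} {j : Reg} (hj : j = .a ∨ j = .a') {w w' : ℕ} (L : List α)
    (hl : s.get j = ones L.length) (hn' : s.n' = []) (hq : s.q = ones w) (hq' : s.q' = ones w')
    (hr' : s.r' = []) :
    (count j .n' ((push .mid false).seq (split true))).Ex s { s with
      mid := (L.flatMap fun _ => false :: ones (w' + 1 + w)).reverse ++ s.mid }
      (L.length * ((w' + w) * 5 + 14) + 4) := by
  have e : ones w' ++ true :: ones w = ones (w' + 1 + w) := by
    rw [cons_ones, ones_append]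
    congr 1
    omega
  refine Ex.of_eq (Ex.count (t := (w' + w) * 5 + 10) (by rcases hj with rfl | rfl <;> decide) L
    (fun p l => { s with
      mid := (p.flatMap fun _ => false :: ones (w' + 1 + w)).reverse ++ s.mid })
    (fun p x l _ => ?_) ?_ rfl) ?_ (by linarith)
  · rcases hj with rfl | rfl <;>
    · refine Ex.of_eq (Ex.seq (ex_push _ _ _) (ex_split (w := w) (w' := w') true hq hq' hr')) ?_
        (by linarith)
      rw [e]
      simp [Mem.set, Mem.get]
  · rcases hj with rfl | rfl
    · have : s.a = ones L.length := hl
      ext1 <;> simp [Mem.set, this, hn']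
    · have : s.a' = ones L.length := hl
      ext1 <;> simp [Mem.set, this, hn']
  · rcases hj with rfl | rfl
    · have : s.a = ones L.length := hl
      simp [Mem.set, this, hn']
    · have : s.a' = ones L.length := hl
      simp [Mem.set, this, hn']

/-- Write the row of a new vertex. -/
def newRow : Cmd Reg :=
  (count .a' .n' ((push .mid false).seq (split true))).seq <|
    (pop .c fun o => o.elim skip fun b => push .mid b).seq <|
    (split false).seq (count .a .n' ((push .mid false).seq (split true)))

/-- With w' new vertices of the same block before the current one and w after it, clique entries are
all ones, except for the diagonal zero in the own block. The bit `b` is the entry for the own old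
vertex. -/
theorem ex_newRow {α : Type*} {w w' : ℕ} {b : Bool} {l : List Bool} (L₁ L₂ : List α)
    (ha : s.a = ones L₂.length) (ha' : s.a' = ones L₁.length) (hn' : s.n' = []) (hq : s.q = ones w)
    (hq' : s.q' = ones w') (hr' : s.r' = []) (hc : s.c = b :: l) :
    newRow.Ex s { s with
      c := l
      mid := ((L₁.flatMap fun _ => false :: ones (w' + 1 + w)) ++
        (b :: (ones w' ++ false :: ones w)) ++
          L₂.flatMap fun _ => false :: ones (w' + 1 + w)).reverse ++ s.mid }
      ((L₁.length + L₂.length + 1) * ((w' + w) * 5 + 14) + 6) := by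
  refine Ex.of_eq (Ex.seq (ex_count_newCell (j := .a') (by simp) L₁ ha' hn' hq hq' hr')
    (Ex.seq (Ex.pop (o := some b) (l := l) ?_ ?_ (ex_push _ _ _))
      (Ex.seq (ex_split (w := w) (w' := w') false hq hq' hr')
        (ex_count_newCell (j := .a) (by simp) L₂ ha hn' hq hq' hr')))) ?_ (by linarith)
  · simp [Mem.get, hc]
  · simp [Mem.get, hc]
  · simp [Mem.get, Mem.set]

end Cmd

/-! ### Lists cut at one element: from counters to index conditions -/

theorem List.length_of_append_cons_eq_finRange {Q : ℕ} {p l : List (Fin Q)} {i : Fin Q}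
    (h : p ++ i :: l = List.finRange Q) : p.length = i ∧ p.length + 1 + l.length = Q := by
  have h₁ : p.length + 1 + l.length = Q := by
    have := congrArg List.length h
    simp at this
    omega
  have h₂ : (p ++ i :: l)[p.length]'(by simp) = i := by simp
  refine ⟨?_, h₁⟩
  conv_rhs => rw [← h₂]
  simp [h]

theorem List.Nodup.ne_of_mem_append_cons {α : Type*} {L₁ L₂ : List α} {v : α}
    (h : (L₁ ++ v :: L₂).Nodup) : (∀ u ∈ L₁, u ≠ v) ∧ ∀ u ∈ L₂, u ≠ v := by
  have h' := (List.nodup_cons.1 (List.nodup_middle.1 h)).1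
  constructor <;>
  · rintro u hu rfl
    exact h' (by simp [hu])

/-- In a list without repetitions `v` occurs only at the cut. This turns the three-part output of
the programs into one expression over all vertices. -/
theorem List.flatMap_ite_eq {α β : Type*} [DecidableEq α] {L₁ L₂ : List α} {v : α}
    (h : (L₁ ++ v :: L₂).Nodup) (f g : α → List β) :
    ((L₁ ++ v :: L₂).flatMap fun u => if u = v then f u else g u) =
      L₁.flatMap g ++ f v ++ L₂.flatMap g := by
  obtain ⟨h₁, h₂⟩ := h.ne_of_mem_append_cons
  rw [List.flatMap_append, List.flatMap_cons, if_pos rfl, List.append_assoc]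
  congr 1
  · exact List.flatMap_congr fun u hu => if_neg (h₁ u hu)
  · congr 1
    exact List.flatMap_congr fun u hu => if_neg (h₂ u hu)

/-- The index i stands for the new vertex with number i + 1, since number 0 is the old vertex. -/
theorem ones_append_replicate {Q m : ℕ} (h : m ≤ Q) :
    ones (Q - m) ++ List.replicate m false =
      (List.finRange Q).map fun i : Fin Q => decide ((i : ℕ) + 1 + m ≤ Q) := by
  apply List.ext_getElem
  · simp; omega
  · intro i h₁ h₂
    simp only [List.length_map, List.length_finRange] at h₂
    rw [List.getElem_append]
    simp only [List.length_replicate, List.getElem_replicate, List.getElem_map,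
      List.getElem_finRange, Fin.cast_mk]
    split <;> simp <;> omega

theorem ones_append_cons_ones {Q : ℕ} {p l : List (Fin Q)} {i : Fin Q}
    (h : p ++ i :: l = List.finRange Q) :
    ones p.length ++ false :: ones l.length =
      (List.finRange Q).map fun i' => decide (i' ≠ i) := by
  have hn : (p ++ i :: l).Nodup := h ▸ List.nodup_finRange Q
  obtain ⟨h₁, h₂⟩ := hn.ne_of_mem_append_cons
  rw [← h, List.map_append, List.map_cons, ones, ones, ← List.map_const', ← List.map_const']
  congr 1
  · exact List.map_congr_left fun u hu => by simp [h₁ u hu]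
  · congr 1
    · simp
    · exact List.map_congr_left fun u hu => by simp [h₂ u hu]

namespace Cmd

variable {s s' s'' : Mem} {t t' : ℕ}

theorem ex_newRows {α : Type*} [DecidableEq α] {Q : ℕ} {L L₁ L₂ : List α} {v : α}
    (hL : L₁ ++ v :: L₂ = L) (hv : L.Nodup) (cb : Fin Q → Bool) (ha : s.a = ones L₂.length)
    (ha' : s.a' = ones L₁.length) (hn' : s.n' = []) (hq : s.q = ones Q) (hq' : s.q' = [])
    (hr' : s.r' = []) (hc : s.c = (List.finRange Q).map cb) :
    (count .q .q' newRow).Ex s { s with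
      c := []
      mid := ((List.finRange Q).flatMap fun i => L.flatMap fun u =>
        if u = v then cb i :: (List.finRange Q).map fun i' => decide (i' ≠ i)
        else false :: ones Q).reverse ++ s.mid }
      (Q * (L.length * (Q * 5 + 14) + 10) + 4) := by
  subst hL
  refine Ex.of_eq (Ex.count (t := (L₁ ++ v :: L₂).length * (Q * 5 + 14) + 6) (by decide)
    (List.finRange Q) (fun p l => { s with
      c := l.map cb
      mid := (p.flatMap fun i => (L₁ ++ v :: L₂).flatMap fun u =>
        if u = v then cb i :: (List.finRange Q).map fun i' => decide (i' ≠ i)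
        else false :: ones Q).reverse ++ s.mid }) (fun p i l hp => ?_) ?_ rfl) ?_ ?_
  · have e := (List.length_of_append_cons_eq_finRange hp).2
    refine Ex.of_eq (ex_newRow (b := cb i) (l := l.map cb) (w := l.length) (w' := p.length)
      L₁ L₂ ha ha' hn' rfl rfl hr' rfl) ?_ ?_
    · rw [ones_append_cons_ones hp, e, List.flatMap_append, List.flatMap_singleton,
        List.flatMap_ite_eq hv]
      simp [Mem.set]
    · have : (L₁ ++ v :: L₂).length = L₁.length + L₂.length + 1 := by
        simp; omega
      rw [this]
      have : p.length + l.length ≤ Q := by omega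
      gcongr
  · ext1 <;> simp [Mem.set, hc, hq, hq']
  · simp [Mem.set, hq, hq']
  · simp only [List.length_finRange]
    linarith

/-- Read a row of the adjacency matrix and write the rows of the old vertex and of the new
vertices that belong to it. -/
def rowBlock : Cmd Reg :=
  scan.seq <| (move .r' .r).seq <| build.seq <| oldRow.seq (count .q .q' newRow)

/-- The rows that `rowBlock` writes. -/
def blockList {α : Type*} [DecidableEq α] (Q : ℕ) (L : List α) (g : α → α → Bool) (v : α) :
    List Bool :=
  (L.flatMap fun u => if u = v then
      g v u :: (List.finRange Q).map fun i : Fin Q => decide ((i : ℕ) + 1 + ((L.map (g v)).count true + 1) ≤ Q)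
    else g v u :: List.replicate Q false) ++
  (List.finRange Q).flatMap fun i : Fin Q => L.flatMap fun u =>
    if u = v then decide ((i : ℕ) + 1 + ((L.map (g v)).count true + 1) ≤ Q) ::
      (List.finRange Q).map fun i' => decide (i' ≠ i)
    else false :: ones Q

theorem ex_rowBlock {α : Type*} [DecidableEq α] {Q : ℕ} {L L₁ L₂ : List α} {v : α}
    (hL : L₁ ++ v :: L₂ = L) (hv : L.Nodup) (g : α → α → Bool) {rest : List Bool}
    (hQ : (L.map (g v)).count true + 1 ≤ Q)
    (hi : s.inp = L.map (g v) ++ rest) (ha : s.a = ones L₂.length)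
    (ha' : s.a' = ones L₁.length) (hn : s.n = ones L.length) (hn' : s.n' = []) (hq : s.q = ones Q)
    (hq' : s.q' = []) (hz : s.z = []) (hc : s.c = []) (hc' : s.c' = []) (hr : s.r = [])
    (hr' : s.r' = []) :
    rowBlock.Ex s { s with inp := rest, mid := (blockList Q L g v).reverse ++ s.mid }
      (L.length * (Q * 5 + 21) + Q * (L.length * (Q * 5 + 14) + 15) + 33) := by
  have hm := ones_append_replicate hQ
  have hlen : (L.map (g v)).length = L.length := List.length_map ..
  have hlen' : L.length = L₁.length + L₂.length + 1 := by
    rw [← hL]; simp; omega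
  have h₁ := ex_scan (w := Q) (row := L.map (g v)) (rest := rest) hi (by rw [hn, hlen]) hn' hq hz
  rw [blockList]
  -- From here on only m ≤ Q matters, which gives (Q - m) + m = Q when `build` restores `q`.
  generalize (L.map (g v)).count true + 1 = m at *
  have h₂ := Ex.of_eq (ex_move (j := .r') (j' := .r) (by decide) { s with
      inp := rest
      r' := (L.map (g v)).reverse ++ s.r'
      q := ones (Q - m)
      z := ones m }) (s'' := { s with
      inp := rest
      r := L.map (g v)
      q := ones (Q - m)
      z := ones m }) (t' := L.length * 2 + 2) (by simp [Mem.set, Mem.get, hr', hr])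
      (by simp [Mem.get, hr'])
  have h₃ := Ex.of_eq (ex_build (s := { s with
      inp := rest
      r := L.map (g v)
      q := ones (Q - m)
      z := ones m }) rfl rfl hc hq') (s'' := { s with
      inp := rest
      r := L.map (g v)
      c := (List.finRange Q).map fun i : Fin Q => decide ((i : ℕ) + 1 + m ≤ Q) })
      (t' := Q * 5 + 6) (by
        ext1 <;> simp only [hm, hz]
        rw [hq]
        congr 1
        omega) (by
        have : Q - m + m = Q := by omega
        rw [this])
  have h₄ := ex_oldRow (s := { s with
      inp := rest
      r := L.map (g v)
      c := (List.finRange Q).map fun i : Fin Q => decide ((i : ℕ) + 1 + m ≤ Q) })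
      (Q := Q) (l₁ := L₁.map (g v)) (l₂ := L₂.map (g v)) (b := g v v) (by simpa using ha)
      (by simpa using ha') hn' hq hq' (by simp [← hL]) (by simp) hc'
  refine Ex.of_eq (Ex.seq h₁ (Ex.seq h₂ (Ex.seq h₃ (Ex.seq h₄ (ex_newRows hL hv
    (fun i => decide ((i : ℕ) + 1 + m ≤ Q)) ha ha' hn' hq hq' hr' rfl))))) ?_ ?_
  · have e := List.flatMap_ite_eq (hL ▸ hv) (fun u => g v u :: (List.finRange Q).map fun i : Fin Q =>
      decide ((i : ℕ) + 1 + m ≤ Q)) (fun u => g v u :: List.replicate Q false)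
    rw [hL] at e
    rw [e]
    ext1 <;> simp [List.flatMap_map, hc, hr]
  · simp only [hlen, List.length_map, ← hlen']
    linarith

theorem ex_count_rowBlock {α : Type*} [DecidableEq α] {Q : ℕ} {L : List α} (hL : L.Nodup)
    (g : α → α → Bool) (hQ : ∀ v, (L.map (g v)).count true + 1 ≤ Q)
    (hi : s.inp = L.flatMap fun v => L.map (g v)) (ha : s.a = ones L.length)
    (ha' : s.a' = []) (hn : s.n = ones L.length) (hn' : s.n' = []) (hq : s.q = ones Q)
    (hq' : s.q' = []) (hz : s.z = []) (hc : s.c = []) (hc' : s.c' = []) (hr : s.r = [])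
    (hr' : s.r' = []) :
    (count .a .a' rowBlock).Ex s { s with
      inp := []
      mid := (L.flatMap (blockList Q L g)).reverse ++ s.mid }
      (L.length * (L.length * (Q * 5 + 21) + Q * (L.length * (Q * 5 + 14) + 15) + 37) + 4) := by
  refine Ex.of_eq (Ex.count
    (t := L.length * (Q * 5 + 21) + Q * (L.length * (Q * 5 + 14) + 15) + 33) (by decide) L
    (fun p l => { s with
      inp := l.flatMap fun v => L.map (g v)
      mid := (p.flatMap (blockList Q L g)).reverse ++ s.mid }) (fun p v l hp => ?_) ?_ rfl) ?_
      (by linarith)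
  · refine Ex.of_eq (ex_rowBlock (Q := Q) hp hL g (rest := l.flatMap fun v => L.map (g v)) (hQ v)
      (by simp [Mem.set]) rfl rfl hn hn' hq hq' hz hc hc' hr hr') ?_ le_rfl
    simp [Mem.set]
  · ext1 <;> simp [Mem.set, hi, ha, ha']
  · simp [Mem.set, ha, ha']

/-! #### Preparing the padded graph -/

/-- Read the two numbers of the input. -/
def parse : Cmd Reg :=
  (whileOne .inp ((push .a true).seq (push .n true))).seq (whileOne .inp (push .k true))

theorem ex_parse (n k : ℕ) (l : List Bool) :
    parse.Ex { inp := ones n ++ false :: (ones k ++ false :: l) }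
      { inp := l, a := ones n, n := ones n, k := ones k } (n * 3 + k * 2 + 4) := by
  have h₁ := Ex.whileOne (t := 2) (j := .inp) (c := (push .a true).seq (push .n true)) n
    (fun i => { inp := ones (n - i) ++ false :: (ones k ++ false :: l), a := ones i, n := ones i })
    (ones k ++ false :: l) (fun i _ => rfl) (fun i _ => by
      refine Ex.of_eq (Ex.seq (ex_push _ _ _) (ex_push _ _ _)) ?_ le_rfl
      simp [Mem.set, Mem.get, List.replicate_succ])
  have h₂ := Ex.whileOne (t := 1) (j := .inp) (c := push .k true) k
    (fun i => { inp := ones (k - i) ++ false :: l, a := ones n, n := ones n, k := ones i })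
    l (fun i _ => rfl) (fun i _ => by
      refine Ex.of_eq (ex_push _ _ _) ?_ le_rfl
      simp [Mem.set, Mem.get, List.replicate_succ])
  exact Ex.of_eq (Ex.seq h₁ h₂) rfl (by linarith)

/-- Write the two numbers of the padded input. -/
def header : Cmd Reg :=
  (count .a .a' ((push .mid true).seq (fill .q .q' true))).seq <|
    (push .mid false).seq <| (fill .k .k' true).seq (push .mid false)

theorem ex_header {n Q k : ℕ} (ha : s.a = ones n) (ha' : s.a' = []) (hq : s.q = ones Q)
    (hq' : s.q' = []) (hk : s.k = ones k) (hk' : s.k' = []) (hm : s.mid = []) :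
    header.Ex s { s with mid := (ones (n * (Q + 1)) ++ [false] ++ ones k ++ [false]).reverse }
      (n * (Q * 5 + 9) + k * 5 + 10) := by
  refine Ex.of_eq (Ex.seq (s' := { s with mid := ones (n * (Q + 1)) })
    (Ex.count (t := Q * 5 + 5) (by decide) (List.range n)
    (fun p l => { s with mid := ones (p.length * (Q + 1)) }) (fun p x l _ => ?_) ?_ ?_)
    (Ex.seq (ex_push _ _ _) (Ex.seq
      (ex_fill (m := k) (by decide) (by decide) (by decide) true hk hk')
      (ex_push _ _ _)))) ?_ ?_
  · refine Ex.of_eq (Ex.seq (ex_push _ _ _) (ex_fill (m := Q) (by decide) (by decide) (by decide)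
      true hq hq')) ?_ (by linarith)
    simp only [Mem.set, Mem.get, cons_ones, ones_append, Mem.mk.injEq, true_and, and_true,
      List.length_append, List.length_singleton]
    congr 1
    ring
  · ext1 <;> simp [Mem.set, ha, ha', hm]
  · simp [Mem.set, ha, ha']
  · simp [Mem.set, Mem.get]
  · simp only [List.length_range]
    linarith

/-- Replace the input by the padded input. -/
def prepare : Cmd Reg := parse.seq <| findWidth.seq <| header.seq (count .a .a' rowBlock)

/-- `W p` is the running maximum of degree + 1 over the vertices in `p`. The counters left in `a`,
`n`, `q`, `k` are kept for the extraction. -/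
theorem ex_prepare {α : Type*} [DecidableEq α] {L : List α} (hL : L.Nodup) (g : α → α → Bool)
    (W : List α → ℕ) (hW : W [] = 0)
    (hW' : ∀ p x, W (p ++ [x]) = max (W p) ((L.map (g x)).count true + 1))
    (hQ : ∀ v, (L.map (g v)).count true + 1 ≤ W L) (k : ℕ) :
    prepare.Ex
      { inp := ones L.length ++ false :: (ones k ++ false :: L.flatMap fun v => L.map (g v)) }
      { mid := (ones (L.length * (W L + 1)) ++ [false] ++ ones k ++ [false] ++
          L.flatMap (blockList (W L) L g)).reverse
        a := ones L.length
        n := ones L.length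
        q := ones (W L)
        k := ones k }
      (L.length * 3 + k * 2 + 4 + (L.length * (L.length * 13 + 17) + 6 +
        (L.length * (W L * 5 + 9) + k * 5 + 10 + (L.length * (L.length * (W L * 5 + 21) +
          W L * (L.length * (W L * 5 + 14) + 15) + 37) + 4)))) := by
  refine Ex.of_eq (Ex.seq (ex_parse _ _ _) (Ex.seq (ex_findWidth L (fun v => L.map (g v)) L.length
    (fun _ => List.length_map ..) W hW hW' rfl rfl rfl rfl rfl rfl rfl rfl) (Ex.seq
      (ex_header rfl rfl rfl rfl rfl rfl rfl) (ex_count_rowBlock hL g hQ rfl rfl rfl rfl rfl rfl rfl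
        rfl rfl rfl rfl rfl)))) ?_ le_rfl
  simp

/-! #### Extracting the result -/

/-- Add one more bit in front of a list, but only `m` ones altogether: the pair `x` consists of the
number of ones that are left and the list. -/
def trimStep (b : Bool) (x : ℕ × List Bool) : ℕ × List Bool :=
  match b, x.1 with
  | true, m + 1 => (m, true :: x.2)
  | _, _ => (x.1, false :: x.2)

/-- Keep the last `m` ones of a list. -/
def trim (m : ℕ) (l : List Bool) : ℕ × List Bool := l.foldr trimStep (m, [])

/-- Read the bits of an old vertex and the new vertices that belong to it. -/
def extractBlock : Cmd Reg :=
  (count .q .q' (pop .mid fun _ => skip)).seq <| pop .mid fun o =>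
    bif o == some true then pop .k fun o' => push .res (o' == some true) else push .res false

/-- The answer is read backwards, so the bits of the new vertices come before that of their old
vertex. Once `k` is empty its pop yields `none`, and a zero is written even for a selected vertex.
-/
theorem ex_extractBlock {Q : ℕ} {b : Bool} {l rest : List Bool} {x : ℕ × List Bool}
    (hl : l.length = Q) (hm : s.mid = l ++ b :: rest) (hq : s.q = ones Q) (hq' : s.q' = [])
    (hk : s.k = ones x.1) (hr : s.res = x.2) :
    extractBlock.Ex s { s with
      mid := rest
      k := ones (trimStep b x).1
      res := (trimStep b x).2 } (Q * 6 + 7) := by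
  subst hl
  refine Ex.of_eq (Ex.seq (s' := { s with mid := b :: rest })
    (Ex.count (t := 2) (by decide) l (fun p l => { s with mid := l ++ b :: rest })
    (fun p x l _ => Ex.of_eq (Ex.pop rfl rfl (ex_skip _)) rfl le_rfl) ?_ ?_)
    (Ex.pop (o := some b) (l := rest) (t := 2) (s' := { s with
      mid := rest
      k := ones (trimStep b x).1
      res := (trimStep b x).2 }) rfl rfl ?_)) rfl (by linarith)
  · ext1 <;> simp [Mem.set, hm, hq, hq']
  · simp [Mem.set, hq, hq']
  · obtain ⟨m, r⟩ := x
    cases b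
    · refine Ex.of_eq (ex_push _ _ _) ?_ (by norm_num)
      simp [Mem.set, Mem.get, trimStep, hk, hr]
    · cases m with
      | zero =>
        refine Ex.of_eq (Ex.pop (o := none) (l := []) ?_ ?_ (ex_push _ _ _)) ?_ le_rfl
        · simp [Mem.get, Mem.set, hk]
        · simp [Mem.get, Mem.set, hk]
        · simp [Mem.set, Mem.get, trimStep, hr]
      | succ m =>
        refine Ex.of_eq (Ex.pop (o := some true) (l := ones m) ?_ ?_ (ex_push _ _ _)) ?_ le_rfl
        · simp [Mem.get, Mem.set, hk, List.replicate_succ]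
        · simp [Mem.get, Mem.set, hk]
        · simp [Mem.set, Mem.get, trimStep, hr]

/-- Empty a stack. -/
def clear (j : Reg) : Cmd Reg := loop j fun _ => skip

theorem ex_clear (j : Reg) (s : Mem) : (clear j).Ex s (s.set j []) ((s.get j).length * 2 + 2) := by
  have := Ex.loop (t := 1) (j := j) (c := fun _ => skip) id (s.get j) (fun _ l => s.set j l)
    (fun p l _ => by rw [Mem.get_set_self, List.map_id]) (fun p x l _ => by
      rw [Mem.set_set, List.map_id]; exact ex_skip _)
  rw [Mem.set_get] at this
  exact this

/-- Turn a solution for the padded graph into a solution for the original graph. -/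
def extract : Cmd Reg :=
  (loop .a fun _ => extractBlock).seq <| (clear .n).seq <| (clear .q).seq (clear .k)

/-- Blocks are met from last to first and their bits are pushed, so `res` ends up in the right
order; this is the right fold in `trim`. -/
theorem ex_extract {α : Type*} (L : List α) {Q : ℕ} (f : α → List Bool)
    (hf : ∀ x, (f x).length = Q) (b : α → Bool) (n k : ℕ) :
    extract.Ex
      { mid := (L.flatMap fun x => b x :: f x).reverse
        a := ones L.length
        n := ones n
        q := ones Q
        k := ones k }
      { res := (trim k (L.map b)).2 }
      (L.length * (Q * 6 + 8) + 2 * n + 2 * Q + 2 * k + 8) := by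
  have hk : ∀ l : List Bool, (trim k l).1 ≤ k := by
    intro l
    induction l with
    | nil => exact le_rfl
    | cons b l ih =>
      change (trimStep b (trim k l)).1 ≤ k
      unfold trimStep
      split
      · simp only
        omega
      · exact ih
  have h := Ex.loop (t := Q * 6 + 7) (j := .a) (c := fun _ => extractBlock) (fun _ => true)
    L.reverse (fun p l => {
      mid := (l.reverse.flatMap fun x => b x :: f x).reverse
      res := (trim k (p.reverse.map b)).2
      a := ones l.length
      n := ones n
      q := ones Q
      k := ones (trim k (p.reverse.map b)).1 }) (fun p l _ => by simp [Mem.get])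
    (fun p x l _ => by
      refine Ex.of_eq (ex_extractBlock (Q := Q) (b := b x) (l := (f x).reverse)
        (rest := (l.reverse.flatMap fun x => b x :: f x).reverse) (x := trim k (p.reverse.map b))
        (by simp [hf]) (by simp [Mem.set]) rfl rfl rfl rfl) ?_ le_rfl
      simp [Mem.set, trim])
  simp only [List.reverse_reverse, List.length_reverse] at h
  refine Ex.of_eq (Ex.seq h (Ex.seq (ex_clear _ _) (Ex.seq (ex_clear _ _) (ex_clear _ _)))) ?_ ?_
  · simp [Mem.set]
  · have := hk (L.map b)
    simp [Mem.set, Mem.get]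
    linarith

/-- The third clause is there for the induction: when no ones are left to spend, exactly m have been
kept. -/
theorem trim_spec (m : ℕ) (l : List Bool) :
    (trim m l).2.length = l.length ∧ (trim m l).2.count true = min m (l.count true) ∧
      (trim m l).1 + (trim m l).2.count true = m ∧
      ∀ i : ℕ, (trim m l).2[i]? = some true → l[i]? = some true := by
  induction l with
  | nil => simp [trim]
  | cons b l ih =>
    obtain ⟨h₁, h₂, h₃, h₄⟩ := ih
    have e : trim m (b :: l) = trimStep b (trim m l) := rfl
    rw [e]
    generalize trim m l = x at *
    obtain ⟨m', r⟩ := x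
    simp only at h₁ h₂ h₃ h₄
    cases b
    · refine ⟨by simpa [trimStep] using h₁, by simpa [trimStep] using h₂,
        by simpa [trimStep] using h₃, ?_⟩
      rintro (_ | i) h
      · simp [trimStep] at h
      · simpa using h₄ i (by simpa [trimStep] using h)
    · cases m' with
      | zero =>
        refine ⟨by simpa [trimStep] using h₁, ?_, by simpa [trimStep] using h₃, ?_⟩
        · simp [trimStep]
          omega
        · rintro (_ | i) h
          · simp [trimStep] at h
          · simpa using h₄ i (by simpa [trimStep] using h)
      | succ m' =>
        refine ⟨by simpa [trimStep] using h₁, ?_, ?_, ?_⟩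
        · simp [trimStep]
          omega
        · simp [trimStep]
          omega
        · rintro (_ | i) h
          · simp
          · simpa using h₄ i (by simpa [trimStep] using h)

end Cmd

/-! ### The encoding of the padded graph -/

theorem List.range_mul_eq_flatMap (m n : ℕ) :
    List.range (m * n) = (List.range m).flatMap fun i => (List.range n).map fun j => j + n * i := by
  induction m with
  | zero => simp
  | succ m ih =>
    rw [Nat.succ_mul, List.range_add, ih, List.range_succ, List.flatMap_append,
      List.flatMap_singleton]
    congr 1
    exact List.map_congr_left fun j _ => by ring

theorem List.finRange_mul_eq_flatMap (m n : ℕ) :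
    List.finRange (m * n) =
      (List.finRange m).flatMap fun i => (List.finRange n).map fun j => finProdFinEquiv (i, j) := by
  apply List.map_injective_iff.2 Fin.val_injective
  rw [List.map_coe_finRange_eq_range, List.range_mul_eq_flatMap, List.map_flatMap,
    ← List.map_coe_finRange_eq_range (n := m), List.flatMap_map]
  refine List.flatMap_congr fun i _ => ?_
  rw [← List.map_coe_finRange_eq_range (n := n), List.map_map, List.map_map]
  rfl

namespace BudgetedGraph

open scoped Classical in
/-- The adjacency matrix. -/
noncomputable def adjBit (I : BudgetedGraph) (u v : Fin I.n) : Bool := decide (I.G.Adj u v)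

theorem encode_eq (I : BudgetedGraph) :
    I.encode = ones I.n ++ false :: (ones I.k ++ false ::
      (List.finRange I.n).flatMap fun u => (List.finRange I.n).map (I.adjBit u)) := by
  simp [encode]
  rfl

theorem count_adjBit (I : BudgetedGraph) (v : Fin I.n) :
    ((List.finRange I.n).map (I.adjBit v)).count true = I.deg v := by
  classical
  rw [deg, ← SimpleGraph.coe_neighborFinset, Set.ncard_coe_finset,
    SimpleGraph.neighborFinset_eq_filter, Fin.univ_def, List.count_eq_countP, List.countP_map,
    List.countP_eq_length_filter]
  simp only [Finset.card, Finset.filter, Multiset.filter_coe, Multiset.coe_card]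
  congr 1
  refine List.filter_congr fun u _ => ?_
  simp [adjBit]

/-- The numbering lists each old vertex directly before its own new vertices, so the matrix can be
written block by block. -/
theorem finRange_padded (I : BudgetedGraph) :
    List.finRange I.padded.n = (List.finRange I.n).flatMap fun v =>
      I.paddedEquiv (v, 0) :: (List.finRange I.width).map fun j => I.paddedEquiv (v, j.succ) := by
  refine (List.finRange_mul_eq_flatMap I.n (I.width + 1)).trans ?_
  refine List.flatMap_congr fun v _ => ?_
  rw [List.finRange_succ, List.map_cons, List.map_map]
  rfl

/-- What the program writes is the adjacency matrix of `padded`; each entry is a case of the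
definition of `paddedGraph`. -/
theorem rows_padded (I : BudgetedGraph) :
    ((List.finRange I.padded.n).flatMap fun u => (List.finRange I.padded.n).map (I.padded.adjBit u)) =
      (List.finRange I.n).flatMap (Cmd.blockList I.width (List.finRange I.n) I.adjBit) := by
  have hadj : ∀ x y, I.padded.adjBit (I.paddedEquiv x) (I.paddedEquiv y) = true ↔
      I.paddedGraph.Adj x y := fun x y => by
    unfold adjBit
    exact (@decide_eq_true_iff _ (_)).trans (I.adj_paddedEquiv x y)
  rw [finRange_padded, List.flatMap_assoc]
  refine List.flatMap_congr fun v _ => ?_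
  rw [List.flatMap_cons, Cmd.blockList, count_adjBit]
  congr 1
  · rw [List.map_flatMap]
    refine List.flatMap_congr fun u _ => ?_
    have h₀ : I.padded.adjBit (I.paddedEquiv (v, 0)) (I.paddedEquiv (u, 0)) = I.adjBit v u := by
      rw [Bool.eq_iff_iff, hadj]
      simp [paddedGraph, adjBit]
    rw [List.map_cons, h₀, List.map_map]
    split_ifs with h
    · subst h
      congr 1
      refine List.map_congr_left fun j _ => ?_
      rw [Function.comp_apply, Bool.eq_iff_iff, hadj]
      simp [paddedGraph]
    · congr 1
      rw [List.map_congr_left (g := fun _ => false), List.map_const', List.length_finRange]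
      intro j _
      rw [Function.comp_apply, Bool.eq_false_iff, Ne, hadj]
      simp [paddedGraph, Ne.symm h]
  · rw [List.flatMap_map]
    refine List.flatMap_congr fun i _ => ?_
    rw [List.map_flatMap]
    refine List.flatMap_congr fun u _ => ?_
    rw [List.map_cons, List.map_map]
    split_ifs with h
    · subst h
      congr 1
      · rw [Bool.eq_iff_iff, hadj]
        simp [paddedGraph]
      · refine List.map_congr_left fun j _ => ?_
        rw [Function.comp_apply, Bool.eq_iff_iff, hadj]
        simp [paddedGraph]
        exact not_congr eq_comm
    · congr 1
      · rw [Bool.eq_false_iff, Ne, hadj]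
        simp [paddedGraph, Ne.symm h]
      · rw [List.map_congr_left (g := fun _ => true), List.map_const', List.length_finRange]
        intro j _
        rw [Function.comp_apply, hadj]
        simp [paddedGraph, Ne.symm h]

theorem encode_padded (I : BudgetedGraph) :
    I.padded.encode = ones (I.n * (I.width + 1)) ++ [false] ++ ones I.k ++ [false] ++
      (List.finRange I.n).flatMap (Cmd.blockList I.width (List.finRange I.n) I.adjBit) := by
  rw [encode_eq, rows_padded]
  simp [padded]

theorem length_encode (I : BudgetedGraph) : I.encode.length = I.n + I.k + I.n * I.n + 2 := by
  rw [encode_eq]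
  simp
  ring

end BudgetedGraph

theorem length_encodeVertexSet (S : Σ n : ℕ, Finset (Fin n)) :
    (encodeVertexSet S).length = S.1 := by
  simp [encodeVertexSet]

theorem count_encodeVertexSet (S : Σ n : ℕ, Finset (Fin n)) :
    (encodeVertexSet S).count true = S.2.card := by
  obtain ⟨n, S⟩ := S
  have : S = Finset.univ.filter fun v => v ∈ S := by ext; simp
  conv_rhs => rw [this]
  rw [encodeVertexSet, Fin.univ_def, List.count_eq_countP, List.countP_map,
    List.countP_eq_length_filter]
  simp only [Finset.card, Finset.filter, Multiset.filter_coe, Multiset.coe_card]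
  congr 1
  refine List.filter_congr fun u _ => ?_
  simp

/-! ### The reduction as a vertex selector -/

namespace VertexSelector

/-- The old vertices that a vertex selector selects from the padded graph. -/
noncomputable def oldVertices (A : VertexSelector) (I : BudgetedGraph) : Finset (Fin I.n) :=
  Finset.univ.filter fun v => I.oldVertex v ∈ A I.padded

/-- Apply a vertex selector to the padded graph, and select `k` of the old vertices it selects (all
of them, if they are less than `k`). -/
noncomputable def viaPadded (A : VertexSelector) : VertexSelector := fun I =>
  Finset.univ.filter fun v =>
    (Cmd.trim I.k (encodeVertexSet ⟨I.n, A.oldVertices I⟩)).2[(v : ℕ)]? = some true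

theorem encodeVertexSet_viaPadded (A : VertexSelector) (I : BudgetedGraph) :
    encodeVertexSet ⟨I.n, A.viaPadded I⟩ =
      (Cmd.trim I.k (encodeVertexSet ⟨I.n, A.oldVertices I⟩)).2 := by
  have h := (Cmd.trim_spec I.k (encodeVertexSet ⟨I.n, A.oldVertices I⟩)).1
  rw [length_encodeVertexSet] at h
  apply List.ext_getElem
  · rw [length_encodeVertexSet, h]
  · intro i h₁ h₂
    have e : (encodeVertexSet ⟨I.n, A.viaPadded I⟩)[i] =
        decide ((⟨i, by rwa [h] at h₂⟩ : Fin I.n) ∈ A.viaPadded I) := by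
      simp [encodeVertexSet]
    rw [e, viaPadded, Bool.eq_iff_iff, decide_eq_true_iff, Finset.mem_filter,
      List.getElem?_eq_getElem h₂]
    simp only [Finset.mem_univ, true_and, Option.some.injEq]

theorem viaPadded_subset (A : VertexSelector) (I : BudgetedGraph) :
    (A.viaPadded I).map I.oldVertex ⊆ A I.padded := by
  intro i hi
  obtain ⟨v, hv, rfl⟩ := Finset.mem_map.1 hi
  have h := (Cmd.trim_spec I.k (encodeVertexSet ⟨I.n, A.oldVertices I⟩)).2.2.2 v
    (Finset.mem_filter.1 hv).2
  simpa [encodeVertexSet, oldVertices] using h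

theorem card_viaPadded (A : VertexSelector) (I : BudgetedGraph) :
    (A.viaPadded I).card = min I.k (A.oldVertices I).card := by
  have h := (Cmd.trim_spec I.k (encodeVertexSet ⟨I.n, A.oldVertices I⟩)).2.1
  rw [← encodeVertexSet_viaPadded, count_encodeVertexSet, count_encodeVertexSet] at h
  exact h

theorem approximatesDkSOn_viaPadded {A : VertexSelector} {a b : ℝ} (ha : 0 < a) (hb : 0 < b)
    (hA : A.ApproximatesFCEC (1 + a / (4 * b))) :
    A.viaPadded.ApproximatesDkSOn (IsModifiedInstance a b) 2 := by
  intro I hI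
  obtain ⟨h₁, h₂⟩ := hA I.padded
  obtain ⟨⟨V, hV⟩, h₃⟩ := I.dksOpt_le_two_mul_internal ha hb hI h₂
  have e : A.oldVertices I = V := by
    ext v
    simp [oldVertices, hV]
  have hc : (A.viaPadded I).card = I.k := by
    rw [card_viaPadded, e]
    rw [hV, Finset.card_map] at h₁
    exact min_eq_left h₁
  exact ⟨hc, h₃ _ (A.viaPadded_subset I) hc⟩

theorem PolyTime.viaPadded {A : VertexSelector} (hA : A.PolyTime) : A.viaPadded.PolyTime := by
  obtain ⟨hA⟩ := hA
  let X : Polynomial ℕ := .X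
  refine polyTime_of_programs hA .inp .mid .res Cmd.prepare Cmd.extract BudgetedGraph.padded
    -- The time bounds of `prepare` and `extract` with every parameter replaced by the input length;
    -- X ^ 2 makes room for the encoding of the padded graph.
    ((X * 3 + X * 2 + 4 + (X * (X * 13 + 17) + 6 +
        (X * (X * 5 + 9) + X * 5 + 10 + (X * (X * (X * 5 + 21) +
          X * (X * (X * 5 + 14) + 15) + 37) + 4)))) + (X * (X * 6 + 8) + 2 * X + 2 * X + 2 * X + 8) +
          X ^ 2)
    (fun I => ?_) (fun I => ?_) (fun I => ?_)
  all_goals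
    have hw := I.width_le
    have hl := I.length_encode
    have hk := I.k_le
    have hnn : I.n * (I.width + 1) ≤ I.n * I.n + I.n := by
      rw [Nat.mul_succ]; gcongr
    simp only [X, Polynomial.eval_add, Polynomial.eval_mul, Polynomial.eval_pow,
      Polynomial.eval_X, Polynomial.eval_ofNat]
    generalize hN : I.encode.length = N at *
  · rw [BudgetedGraph.length_encode]
    change I.n * (I.width + 1) + I.k + (I.n * (I.width + 1)) * (I.n * (I.width + 1)) + 2 ≤ _
    -- The input contains an n × n matrix, so N ≥ n² + n, which bounds the number of padded
    -- vertices.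
    have h₁ : I.n * (I.width + 1) ≤ N := by omega
    have h₂ := Nat.mul_le_mul h₁ h₁
    nlinarith
  · rw [length_encodeVertexSet]
    change I.n * (I.width + 1) ≤ _
    nlinarith
  · have hn : I.n ≤ N := by omega
    have hk : I.k ≤ N := by omega
    have hw : I.width ≤ N := by omega
    -- The memory kept while the given machine runs.
    let s : Mem := { a := ones I.n, n := ones I.n, q := ones I.width, k := ones I.k }
    refine ⟨s.get, rfl, ?_, ?_⟩
    · obtain ⟨W, hW, hW', hW''⟩ : ∃ W : List (Fin I.n) → ℕ, W [] = 0 ∧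
          (∀ p x, W (p ++ [x]) = max (W p) (I.deg x + 1)) ∧ W (List.finRange I.n) = I.width := by
        refine ⟨fun p => p.toFinset.sup fun v => I.deg v + 1, rfl, fun p x => ?_, ?_⟩
        · simp only [List.toFinset_append, Finset.sup_union]
          simp
        · simp only [List.toFinset_finRange]
          rfl
      have h := Cmd.ex_prepare (List.nodup_finRange I.n) I.adjBit W hW
        (fun p x => by rw [hW', I.count_adjBit]) (fun v => by
          rw [I.count_adjBit, hW'']
          exact I.deg_lt_width v) I.k
      rw [hW'', List.length_finRange, ← I.encode_eq, ← I.encode_padded] at h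
      have e₁ : ({ inp := I.encode } : Mem).get = Cmd.only .inp I.encode :=
        (Mem.get_set { } .inp I.encode).trans (by congr; funext j; cases j <;> rfl)
      have e₂ : ({ s with mid := I.padded.encode.reverse } : Mem).get =
          Function.update s.get .mid I.padded.encode.reverse :=
        Mem.get_set s .mid _
      rw [← e₁, ← e₂]
      refine Cmd.Exec.mono h (le_trans (b := N * 3 + N * 2 + 4 + (N * (N * 13 + 17) + 6 +
        (N * (N * 5 + 9) + N * 5 + 10 + (N * (N * (N * 5 + 21) +
          N * (N * (N * 5 + 14) + 15) + 37) + 4)))) ?_ ?_)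
      · gcongr
      · exact (Nat.le_add_right _ _).trans (Nat.le_add_right _ _)
    · have h := Cmd.ex_extract (List.finRange I.n) (Q := I.width)
        (fun v => (List.finRange I.width).map fun j =>
          decide (I.paddedEquiv (v, j.succ) ∈ A I.padded)) (fun v => by simp)
        (fun v => decide (v ∈ A.oldVertices I)) I.n I.k
      have e₁ : ({ s with mid := (encodeVertexSet ⟨I.padded.n, A I.padded⟩).reverse } : Mem).get =
          Function.update s.get .mid (encodeVertexSet ⟨I.padded.n, A I.padded⟩).reverse :=
        Mem.get_set s .mid _
      have e₂ : ({ res := encodeVertexSet ⟨I.n, A.viaPadded I⟩ } : Mem).get =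
          Cmd.only .res (encodeVertexSet ⟨I.n, A.viaPadded I⟩) :=
        (Mem.get_set { } .res _).trans (by congr; funext j; cases j <;> rfl)
      have e₃ : encodeVertexSet ⟨I.padded.n, A I.padded⟩ = (List.finRange I.n).flatMap fun v =>
          decide (v ∈ A.oldVertices I) :: (List.finRange I.width).map fun j =>
            decide (I.paddedEquiv (v, j.succ) ∈ A I.padded) := by
        rw [encodeVertexSet, I.finRange_padded, List.map_flatMap]
        refine List.flatMap_congr fun v _ => ?_
        rw [List.map_cons, List.map_map]
        congr 1
        simp only [oldVertices, Finset.mem_filter, Finset.mem_univ, true_and]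
        rfl
      rw [← e₁, ← e₂, e₃, encodeVertexSet_viaPadded]
      rw [List.length_finRange] at h
      refine Cmd.Exec.mono h (le_trans (b := N * (N * 6 + 8) + 2 * N + 2 * N + 2 * N + 8) ?_ ?_)
      · gcongr
      · exact (Nat.le_add_left _ _).trans (Nat.le_add_right _ _)

end VertexSelector

theorem theorem5p2 :
    (HasPTASForFCEC →
      ∀ a b : ℝ, 0 < a → 0 < b →
        ∃ ρ : ℝ, 1 ≤ ρ ∧ ∃ A : VertexSelector,
          A.PolyTime ∧ A.ApproximatesDkSOn (IsModifiedInstance a b) ρ) ∧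
    (∀ (I : BudgetedGraph) (U : Finset (Fin I.n)),
      I.touching U + I.internal U = ∑ v ∈ U, I.deg v) ∧
    (∀ (I : BudgetedGraph) (d : ℕ), (∀ v, I.deg v = d) →
      I.fcecOpt + I.dksOpt = d * I.k ∧
      ∀ U : Finset (Fin I.n), U.card = I.k →
        (I.touching U = I.fcecOpt ↔ I.internal U = I.dksOpt)) := by
  refine ⟨fun h a b ha hb => ?_, fun I U => I.touching_add_internal U, fun I d hd =>
    ⟨I.fcecOpt_add_dksOpt_of_deg_eq hd, fun U hU => I.touching_eq_fcecOpt_iff_of_deg_eq hd hU⟩⟩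
  obtain ⟨A, hA, hA'⟩ := h (a / (4 * b)) (by positivity)
  exact ⟨2, one_le_two, A.viaPadded, hA.viaPadded,
    VertexSelector.approximatesDkSOn_viaPadded ha hb hA'⟩
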